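/- Lie groups are real, finite-dimensional and smooth ($C^\infty$). Let $L=A\bowtie B$ be a matched pair of Lie groups: $A$ and $B$ are Lie subgroups of a Lie group $L$ such that the multiplication of $L$ restricts to a diffeomorphism $A\times B\to L$, $(a,b)\mapsto ab$. Then $A$ is closed in $L$. Let $\mathfrak a\subset\mathfrak l$ be the Lie algebras of $A$ and $L$, and let $A$ act on $\mathfrak l/\mathfrak a$ by the action $\mathrm{Ad}$ induced by the adjoint action of $A\subset L$ on $\mathfrak l$. The Atiyah class of $(L,A)$ is the following element of the first smooth group cohomology $H^1\big(A,(\mathfrak l/\mathfrak a)^*\otimes\mathrm{End}(\mathfrak l/\mathfrak a)\big)$. Choose a bilinear map $\nabla:\mathfrak l\times\mathfrak l/\mathfrak a\to\mathfrak l/\mathfrak a$ such that, for $x\in\mathfrak a$, $\nabla_x$ is the infinitesimal action of $x$ on $\mathfrak l/\mathfrak a$ (the derivative of the $A$-action at the identity); the class is that of the cocycle $$R^\nabla(\gamma)(\bar l,e)=\mathrm{Ad}_\gamma\,\nabla_{\mathrm{Ad}_{\gamma^{-1}}l}\big(\mathrm{Ad}_{\gamma^{-1}}e\big)-\nabla_l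 e ,\qquad \gamma\in A,\ l\in\mathfrak l,\ e\in\mathfrak l/\mathfrak a,$$ and it does not depend on the choice of $\nabla$. The dressing action of $A$ on $B$, written $(a,b)\mapsto a\triangleright b$, is the action that corresponds to left translation by $A$ on $L/A$ under the bijection $B\to L/A$, $b\mapsto bA$; that is, $a\triangleright b$ is the unique element of $B$ with $ab\in (a\triangleright b)A$. If the Atiyah class of $(L,A)$ vanishes, then the dressing action of $A$ on $B$ is linearizable near the identity: there are an open neighborhood $U$ of $0$ in $\mathfrak l/\mathfrak a$, an open neighborhood $V$ of $1$ in $B$ and a diffeomorphism $\Phi:U\to V$ with $\Phi(0)=1$ such that $$\Phi(\mathrm{Ad}_a\beta)=a\triangleright\Phi(\beta)$$ for all $a\in A$ and all $\beta\in U$ with $\mathrm{Ad}_a\beta\in U$. -/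

import Mathlib

open Topology
open scoped Manifold ContDiff

noncomputable section

set_option linter.unusedSectionVars false

namespace LiePair

/-! Throughout, manifolds are real, finite dimensional and without boundary: a manifold `M` is
modelled on a finite dimensional normed space `E` through the model `𝓘(ℝ, E)`, and the tangent
space of `M` at any point is, by definition in Mathlib, a copy of `E`. In particular the Lie
algebra of a Lie group modelled on `E` has underlying vector space `E`. -/

section Tangent

variable {E : Type*} [NormedAddCommGroup E] [NormedSpace ℝ E]
  {M : Type*} [TopologicalSpace M] [ChartedSpace E M]
  {E' : Type*} [NormedAddCommGroup E'] [NormedSpace ℝ E']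
  {M' : Type*} [TopologicalSpace M'] [ChartedSpace E' M']
  {E'' : Type*} [NormedAddCommGroup E''] [NormedSpace ℝ E'']
  {M'' : Type*} [TopologicalSpace M''] [ChartedSpace E'' M'']

/-- The differential `T_x f : T_x M → T_{f x} M'` of `f`, as a map between the model spaces. -/
def tangentAt (f : M → M') (x : M) : E →L[ℝ] E' := mfderiv 𝓘(ℝ, E) 𝓘(ℝ, E') f x

theorem tangentAt_comp {g : M' → M''} {f : M → M'}
    (hg : ContMDiff 𝓘(ℝ, E') 𝓘(ℝ, E'') ∞ g)
    (hf : ContMDiff 𝓘(ℝ, E) 𝓘(ℝ, E') ∞ f) (x : M) :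
    (tangentAt (fun y => g (f y)) x : E →L[ℝ] E'') =
      (tangentAt g (f x) : E' →L[ℝ] E'').comp (tangentAt f x) :=
  mfderiv_comp x (hg.mdifferentiableAt (by simp)) (hf.mdifferentiableAt (by simp))

theorem tangentAt_id (x : M) :
    tangentAt (fun y : M => y) x = ContinuousLinearMap.id ℝ E :=
  mfderiv_id

theorem tangentAt_clm (T : E →L[ℝ] E') (x : E) : tangentAt (fun y => T y) x = T := by
  have h : tangentAt (fun y => T y) x = fderiv ℝ T x := mfderiv_eq_fderiv
  rw [h, T.fderiv]

theorem inTangentCoordinates_const [IsManifold 𝓘(ℝ, E) 1 M] [IsManifold 𝓘(ℝ, E') 1 M']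
    {N : Type*} (a : M) (b : M') (φ : N → E →L[ℝ] E') (x₀ x : N) :
    inTangentCoordinates 𝓘(ℝ, E) 𝓘(ℝ, E') (fun _ => a) (fun _ => b) φ x₀ x = φ x := by
  refine (inTangentCoordinates_eq (I := 𝓘(ℝ, E)) (I' := 𝓘(ℝ, E')) (fun _ : N => a) (fun _ : N => b)
    φ (x₀ := x₀) (x := x) (mem_chart_source _ _) (mem_chart_source _ _)).trans ?_
  ext v
  simp only [ContinuousLinearMap.comp_apply]
  rw [(tangentBundleCore 𝓘(ℝ, E) M).coordChange_self _ _ (mem_achart_source E a),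
    (tangentBundleCore 𝓘(ℝ, E') M').coordChange_self _ _ (mem_achart_source E' b)]

end Tangent

section Adjoint

variable {E : Type*} [NormedAddCommGroup E] [NormedSpace ℝ E]
  {L : Type*} [TopologicalSpace L] [ChartedSpace E L] [Group L]

/-- The adjoint action of `g` on the Lie algebra `T_1 L`: the differential at `1` of
`h ↦ g h g⁻¹`. -/
def Ad (g : L) : E →L[ℝ] E := tangentAt (fun h : L => g * h * g⁻¹) 1

theorem Ad_one : (Ad (1 : L) : E →L[ℝ] E) = ContinuousLinearMap.id ℝ E := by
  have h : (fun h : L => 1 * h * 1⁻¹) = fun h => h := by ext h; simp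
  rw [Ad, h, tangentAt_id]

variable [LieGroup 𝓘(ℝ, E) ∞ L]

theorem contMDiff_conj (g : L) :
    ContMDiff 𝓘(ℝ, E) 𝓘(ℝ, E) ∞ (fun h : L => g * h * g⁻¹) :=
  (contMDiff_const.mul contMDiff_id).mul contMDiff_const

theorem Ad_mul (g h : L) : (Ad (g * h) : E →L[ℝ] E) = (Ad g : E →L[ℝ] E).comp (Ad h) := by
  have e : (fun k : L => g * h * k * (g * h)⁻¹) =
      fun k => (fun k' => g * k' * g⁻¹) ((fun k' => h * k' * h⁻¹) k) := by
    ext k; simp [mul_assoc]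
  rw [Ad, e, tangentAt_comp (contMDiff_conj g) (contMDiff_conj h)]
  simp [Ad]

theorem contMDiff_Ad :
    ContMDiff 𝓘(ℝ, E) 𝓘(ℝ, E →L[ℝ] E) ∞ (fun g : L => (Ad g : E →L[ℝ] E)) := by
  have : IsManifold 𝓘(ℝ, E) 1 L := IsManifold.of_le (n := ∞) (by simp)
  intro g₀
  have hf : ContMDiffAt (𝓘(ℝ, E).prod 𝓘(ℝ, E)) 𝓘(ℝ, E) ∞
      (Function.uncurry fun g h : L => g * h * g⁻¹) (g₀, 1) := by
    have : ContMDiff (𝓘(ℝ, E).prod 𝓘(ℝ, E)) 𝓘(ℝ, E) ∞ (fun p : L × L => p.1 * p.2 * p.1⁻¹) :=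
      (contMDiff_fst.mul contMDiff_snd).mul contMDiff_fst.inv
    exact this.contMDiffAt
  have key := ContMDiffAt.mfderiv (m := ∞) (fun g h : L => g * h * g⁻¹) (fun _ : L => (1 : L)) hf
    contMDiffAt_const (by simp)
  have aux : ∀ u : L → L, u = (fun _ => 1) →
      inTangentCoordinates 𝓘(ℝ, E) 𝓘(ℝ, E) (fun _ : L => (1 : L)) u (fun g : L => (Ad g : E →L[ℝ] E))
        g₀ = fun g : L => (Ad g : E →L[ℝ] E) := by
    rintro u rfl
    exact funext fun g => inTangentCoordinates_const 1 1 _ g₀ g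
  have e := aux (fun x : L => x * 1 * x⁻¹) (by ext; simp)
  rw [← e]
  exact key

end Adjoint

section Rep

/-- A module of a Lie group `A`: a vector space `V` with a smooth linear action of `A`. -/
structure Rep (E : Type*) [NormedAddCommGroup E] [NormedSpace ℝ E]
    (A : Type*) [TopologicalSpace A] [ChartedSpace E A] [Group A]
    (V : Type*) [NormedAddCommGroup V] [NormedSpace ℝ V] where
  /-- the action, as a morphism of `A` to the linear endomorphisms of `V` (the image of a group
  consists of invertible elements) -/
  act : A →* (V →L[ℝ] V)
  contMDiff_act : ContMDiff 𝓘(ℝ, E) 𝓘(ℝ, V →L[ℝ] V) ∞ act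

namespace Rep

variable {E : Type*} [NormedAddCommGroup E] [NormedSpace ℝ E]
  {A : Type*} [TopologicalSpace A] [ChartedSpace E A] [Group A]
  {V : Type*} [NormedAddCommGroup V] [NormedSpace ℝ V]
  {W : Type*} [NormedAddCommGroup W] [NormedSpace ℝ W]

theorem act_mul_apply (ρ : Rep E A V) (a b : A) (v : V) :
    ρ.act (a * b) v = ρ.act a (ρ.act b v) := by
  rw [map_mul]; rfl

theorem act_one_apply (ρ : Rep E A V) (v : V) : ρ.act 1 v = v := by
  rw [map_one]; rfl

/-- The action of the Lie algebra on a module, obtained by differentiating the group action at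
the identity. -/
def infinitesimal (ρ : Rep E A V) : E →L[ℝ] (V →L[ℝ] V) := tangentAt ρ.act 1

variable [LieGroup 𝓘(ℝ, E) ∞ A]

/-- The linear map `f ↦ T ∘ f ∘ S` on `Hom(V, W)`. -/
def homMap (S : V →L[ℝ] V) (T : W →L[ℝ] W) : (V →L[ℝ] W) →L[ℝ] (V →L[ℝ] W) :=
  ((ContinuousLinearMap.compL ℝ V V W).flip S).comp (ContinuousLinearMap.compL ℝ V W W T)

theorem homMap_apply (S : V →L[ℝ] V) (T : W →L[ℝ] W) (f : V →L[ℝ] W) (v : V) :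
    homMap S T f v = T (f (S v)) := rfl

theorem contMDiff_homMap {S : A → V →L[ℝ] V} {T : A → W →L[ℝ] W}
    (hS : ContMDiff 𝓘(ℝ, E) 𝓘(ℝ, V →L[ℝ] V) ∞ S) (hT : ContMDiff 𝓘(ℝ, E) 𝓘(ℝ, W →L[ℝ] W) ∞ T) :
    ContMDiff 𝓘(ℝ, E) 𝓘(ℝ, (V →L[ℝ] W) →L[ℝ] (V →L[ℝ] W)) ∞ (fun a => homMap (S a) (T a)) :=
  ((ContinuousLinearMap.contMDiff (ContinuousLinearMap.compL ℝ V V W).flip).comp hS).clm_comp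
    ((ContinuousLinearMap.contMDiff (ContinuousLinearMap.compL ℝ V W W)).comp hT)

/-- The module `Hom(V, W)`, with `(a · T) v = a · T (a⁻¹ · v)`. -/
def hom (ρ : Rep E A V) (σ : Rep E A W) : Rep E A (V →L[ℝ] W) where
  act :=
    { toFun := fun a => homMap (ρ.act a⁻¹) (σ.act a)
      map_one' := by
        ext f v
        rw [homMap_apply, inv_one, act_one_apply, act_one_apply]
        rfl
      map_mul' := fun a b => by
        ext f v
        change homMap _ _ f v = homMap (ρ.act a⁻¹) (σ.act a) (homMap (ρ.act b⁻¹) (σ.act b) f) v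
        simp only [homMap_apply, mul_inv_rev, act_mul_apply] }
  contMDiff_act :=
    contMDiff_homMap (ρ.contMDiff_act.comp (contMDiff_inv 𝓘(ℝ, E) ∞)) σ.contMDiff_act

theorem hom_act_apply (ρ : Rep E A V) (σ : Rep E A W) (a : A) (T : V →L[ℝ] W) (v : V) :
    (ρ.hom σ).act a T v = σ.act a (T (ρ.act a⁻¹ v)) := rfl

/-- The smooth 1-cocycles `F : A → V`, i.e. the smooth maps with `F (a b) = a · F b + F a`. -/
def cocycles (ρ : Rep E A V) : Submodule ℝ C^∞⟮𝓘(ℝ, E), A; 𝓘(ℝ, V), V⟯ where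
  carrier := {F | ∀ a b, F (a * b) = ρ.act a (F b) + F a}
  add_mem' := fun {F G} hF hG a b => by
    simp only [Set.mem_ofPred_eq] at hF hG
    simp only [ContMDiffMap.coe_add, Pi.add_apply, hF a b, hG a b, map_add]
    abel
  zero_mem' := fun a b => by simp
  smul_mem' := fun c F hF a b => by
    simp only [Set.mem_ofPred_eq] at hF
    simp only [ContMDiffMap.coe_smul, Pi.smul_apply, hF a b, map_smul, smul_add]

/-- The differential `C⁰ → Z¹`, sending `v ∈ V` to the coboundary `a ↦ a · v - v`. -/
def coboundary (ρ : Rep E A V) : V →ₗ[ℝ] ρ.cocycles where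
  toFun v :=
    ⟨⟨fun a => ρ.act a v - v,
      (ρ.contMDiff_act.clm_apply contMDiff_const).sub contMDiff_const⟩, fun a b => by
        change ρ.act (a * b) v - v = ρ.act a (ρ.act b v - v) + (ρ.act a v - v)
        rw [act_mul_apply, map_sub]
        abel⟩
  map_add' v w := by
    ext a
    change ρ.act a (v + w) - (v + w) = (ρ.act a v - v) + (ρ.act a w - w)
    rw [map_add]
    abel
  map_smul' c v := by
    ext a
    change ρ.act a (c • v) - c • v = c • (ρ.act a v - v)
    rw [map_smul, smul_sub]

/-- The first smooth group cohomology `H¹(A, V)`. -/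
abbrev H1 (ρ : Rep E A V) : Type _ := ρ.cocycles ⧸ LinearMap.range ρ.coboundary

theorem infinitesimal_Ad (ρ : Rep E A V) (a : A) (x : E) :
    ρ.infinitesimal (Ad a x) =
      ((ρ.act a).comp (ρ.infinitesimal x)).comp (ρ.act a⁻¹) := by
  have e : (fun h : A => ρ.act (a * h * a⁻¹)) =
      fun h => homMap (ρ.act a⁻¹) (ρ.act a) (ρ.act h) := by
    ext h v
    simp only [homMap_apply, act_mul_apply]
  have h1 := tangentAt_comp ρ.contMDiff_act (contMDiff_conj a) 1
  have h2 := tangentAt_comp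
    (homMap (ρ.act a⁻¹) (ρ.act a)).contMDiff ρ.contMDiff_act 1
  rw [tangentAt_clm] at h2
  have h3 : a * 1 * a⁻¹ = 1 := by simp
  rw [h3, e, h2] at h1
  exact (DFunLike.congr_fun h1 x).symm

end Rep

end Rep

section Pair

/-- A Lie subgroup `A` of a Lie group `L`: a Lie group together with a smooth morphism to `L` that
is an injective immersion. -/
structure LieSubgroup
    (EA : Type*) [NormedAddCommGroup EA] [NormedSpace ℝ EA]
    (A : Type*) [TopologicalSpace A] [ChartedSpace EA A] [Group A]
    (EL : Type*) [NormedAddCommGroup EL] [NormedSpace ℝ EL]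
    (L : Type*) [TopologicalSpace L] [ChartedSpace EL L] [Group L] where
  incl : A →* L
  contMDiff_incl : ContMDiff 𝓘(ℝ, EA) 𝓘(ℝ, EL) ∞ incl
  injective_incl : Function.Injective incl
  injective_tangentAt : ∀ a, Function.Injective (tangentAt incl a : EA →L[ℝ] EL)

/-- A Lie group pair `(L, A)`: a Lie group `L` and a closed Lie subgroup `A` of `L`. -/
structure LieGroupPair
    (EA : Type*) [NormedAddCommGroup EA] [NormedSpace ℝ EA]
    (A : Type*) [TopologicalSpace A] [ChartedSpace EA A] [Group A]
    (EL : Type*) [NormedAddCommGroup EL] [NormedSpace ℝ EL]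
    (L : Type*) [TopologicalSpace L] [ChartedSpace EL L] [Group L]
    extends LieSubgroup EA A EL L where
  isClosedEmbedding_incl : IsClosedEmbedding incl

namespace LieGroupPair

variable {EA : Type*} [NormedAddCommGroup EA] [NormedSpace ℝ EA] [FiniteDimensional ℝ EA]
  {A : Type*} [TopologicalSpace A] [ChartedSpace EA A] [Group A] [LieGroup 𝓘(ℝ, EA) ∞ A]
  {EL : Type*} [NormedAddCommGroup EL] [NormedSpace ℝ EL] [FiniteDimensional ℝ EL]
  {L : Type*} [TopologicalSpace L] [ChartedSpace EL L] [Group L] [LieGroup 𝓘(ℝ, EL) ∞ L]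
  {V : Type*} [NormedAddCommGroup V] [NormedSpace ℝ V]

/-- The inclusion of the Lie algebra of `A` in the Lie algebra of `L`. -/
def algIncl (P : LieGroupPair EA A EL L) : EA →L[ℝ] EL := tangentAt P.incl 1

/-- The Lie algebra of `A`, as a subspace of the Lie algebra of `L`. -/
def subalg (P : LieGroupPair EA A EL L) : Submodule ℝ EL := LinearMap.range P.algIncl.toLinearMap

instance (P : LieGroupPair EA A EL L) : IsClosed (P.subalg : Set EL) :=
  Submodule.closed_of_finiteDimensional _

/-- The quotient of the Lie algebra of `L` by the Lie algebra of `A`. -/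
abbrev AlgQuot (P : LieGroupPair EA A EL L) : Type _ := EL ⧸ P.subalg

theorem Ad_algIncl (P : LieGroupPair EA A EL L) (a : A) (x : EA) :
    Ad (P.incl a) (P.algIncl x) = P.algIncl (Ad a x) := by
  have e : (fun h : A => P.incl (a * h * a⁻¹)) =
      fun h => (fun k : L => P.incl a * k * (P.incl a)⁻¹) (P.incl h) := by
    ext h
    simp
  have h1 := tangentAt_comp P.contMDiff_incl (contMDiff_conj a) 1
  have h2 := tangentAt_comp (contMDiff_conj (P.incl a)) P.contMDiff_incl 1
  have h3 : a * 1 * a⁻¹ = 1 := by simp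
  rw [map_one] at h2
  rw [h3, e, h2] at h1
  exact DFunLike.congr_fun h1 x

theorem Ad_mem_subalg (P : LieGroupPair EA A EL L) (a : A) {l : EL} (hl : l ∈ P.subalg) :
    Ad (P.incl a) l ∈ P.subalg := by
  obtain ⟨x, rfl⟩ := hl
  exact ⟨Ad a x, (P.Ad_algIncl a x).symm⟩

/-- The map induced by the adjoint action of `a ∈ A` on the quotient of the Lie algebras. -/
def quotAd (P : LieGroupPair EA A EL L) (a : A) : P.AlgQuot →L[ℝ] P.AlgQuot :=
  P.subalg.liftQL (P.subalg.mkQL.comp (Ad (P.incl a) : EL →L[ℝ] EL)) fun l hl => by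
    simpa using! P.Ad_mem_subalg a hl

theorem quotAd_mk (P : LieGroupPair EA A EL L) (a : A) (l : EL) :
    P.quotAd a (P.subalg.mkQL l) = P.subalg.mkQL (Ad (P.incl a) l) := rfl

/-- The canonical `A`-module structure on the quotient of the Lie algebra of `L` by the one of
`A`: the action induced by the adjoint action of `A ⊆ L`. -/
def quotRep (P : LieGroupPair EA A EL L) : Rep EA A P.AlgQuot where
  act :=
    { toFun := P.quotAd
      map_one' := by
        ext q
        obtain ⟨l, rfl⟩ := P.subalg.mkQ_surjective q
        change P.quotAd 1 (P.subalg.mkQL l) = P.subalg.mkQL l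
        rw [quotAd_mk, map_one, Ad_one]
        rfl
      map_mul' := fun a b => by
        ext q
        obtain ⟨l, rfl⟩ := P.subalg.mkQ_surjective q
        change P.quotAd (a * b) (P.subalg.mkQL l) = P.quotAd a (P.quotAd b (P.subalg.mkQL l))
        rw [quotAd_mk, quotAd_mk, quotAd_mk, map_mul, Ad_mul]
        rfl }
  contMDiff_act := by
    obtain ⟨s, hs⟩ := P.subalg.mkQ.exists_rightInverse_of_surjective P.subalg.range_mkQ
    have e : P.quotAd = fun a => P.subalg.mkQL.comp
        ((Ad (P.incl a) : EL →L[ℝ] EL).comp (LinearMap.toContinuousLinearMap s)) := by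
      ext a q
      have h : P.subalg.mkQL (s q) = q := DFunLike.congr_fun hs q
      conv_lhs => rw [← h]
      rfl
    change ContMDiff _ _ _ P.quotAd
    rw [e]
    exact contMDiff_const.clm_comp
      ((contMDiff_Ad.comp P.contMDiff_incl).clm_comp contMDiff_const)

/-- A connection of the Lie algebra of `L` on an `A`-module `V` (a bilinear assignment
`(l, v) ↦ ∇_l v`) that extends the action of the Lie algebra of `A`. -/
structure Connection (P : LieGroupPair EA A EL L) (ρ : Rep EA A V) where
  nabla : EL →L[ℝ] (V →L[ℝ] V)
  nabla_algIncl : ∀ x : EA, nabla (P.algIncl x) = ρ.infinitesimal x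

theorem nonempty_connection (P : LieGroupPair EA A EL L) (ρ : Rep EA A V) :
    Nonempty (P.Connection ρ) := by
  have hk : LinearMap.ker P.algIncl.toLinearMap = ⊥ :=
    LinearMap.ker_eq_bot.2 (P.injective_tangentAt 1)
  obtain ⟨s, hs⟩ := P.algIncl.toLinearMap.exists_leftInverse_of_injective hk
  refine ⟨⟨ρ.infinitesimal.comp (LinearMap.toContinuousLinearMap s), fun x => ?_⟩⟩
  have h : s (P.algIncl x) = x := DFunLike.congr_fun hs x
  change ρ.infinitesimal (s (P.algIncl x)) = _
  rw [h]

/-- The `A`-module `Hom(𝔩/𝔞, End V) = (𝔩/𝔞)^* ⊗ End V`. -/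
abbrev coeffRep (P : LieGroupPair EA A EL L) (ρ : Rep EA A V) :
    Rep EA A (P.AlgQuot →L[ℝ] (V →L[ℝ] V)) :=
  P.quotRep.hom (ρ.hom ρ)

/-- The failure of `A`-equivariance of a connection:
`(l, v) ↦ a · ∇_{Ad(a⁻¹) l} (a⁻¹ · v) - ∇_l v`. -/
def Connection.defect {P : LieGroupPair EA A EL L} {ρ : Rep EA A V} (D : P.Connection ρ) (a : A) :
    EL →L[ℝ] (V →L[ℝ] V) :=
  ((ρ.hom ρ).act a).comp (D.nabla.comp (Ad (P.incl a⁻¹) : EL →L[ℝ] EL)) - D.nabla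

theorem Connection.defect_apply {P : LieGroupPair EA A EL L} {ρ : Rep EA A V}
    (D : P.Connection ρ) (a : A) (l : EL) (v : V) :
    D.defect a l v = ρ.act a (D.nabla (Ad (P.incl a⁻¹) l) (ρ.act a⁻¹ v)) - D.nabla l v := rfl

theorem Connection.defect_subalg {P : LieGroupPair EA A EL L} {ρ : Rep EA A V}
    (D : P.Connection ρ) (a : A) {l : EL} (hl : l ∈ P.subalg) : D.defect a l = 0 := by
  obtain ⟨x, rfl⟩ := hl
  ext v
  change D.defect a (P.algIncl x) v = 0
  rw [D.defect_apply, P.Ad_algIncl, D.nabla_algIncl, D.nabla_algIncl, ρ.infinitesimal_Ad]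
  simp [← ρ.act_mul_apply]

/-- The value at `a` of the Atiyah cocycle: the map `𝔩/𝔞 → End V` induced by the defect. -/
def Connection.cocycleFun {P : LieGroupPair EA A EL L} {ρ : Rep EA A V} (D : P.Connection ρ) (a : A) :
    P.AlgQuot →L[ℝ] (V →L[ℝ] V) :=
  P.subalg.liftQL (D.defect a) fun _ hl => D.defect_subalg a hl

theorem Connection.cocycleFun_mk {P : LieGroupPair EA A EL L} {ρ : Rep EA A V} (D : P.Connection ρ)
    (a : A) (l : EL) (v : V) : D.cocycleFun a (P.subalg.mkQL l) v =
      ρ.act a (D.nabla (Ad (P.incl a⁻¹) l) (ρ.act a⁻¹ v)) - D.nabla l v := rfl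

theorem Connection.contMDiff_cocycleFun {P : LieGroupPair EA A EL L} {ρ : Rep EA A V}
    (D : P.Connection ρ) :
    ContMDiff 𝓘(ℝ, EA) 𝓘(ℝ, P.AlgQuot →L[ℝ] (V →L[ℝ] V)) ∞ D.cocycleFun := by
  obtain ⟨s, hs⟩ := P.subalg.mkQ.exists_rightInverse_of_surjective P.subalg.range_mkQ
  have e : D.cocycleFun = fun a => (D.defect a).comp (LinearMap.toContinuousLinearMap s) := by
    ext a q v
    have h : P.subalg.mkQL (s q) = q := DFunLike.congr_fun hs q
    conv_lhs => rw [← h]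
    rfl
  rw [e]
  refine ContMDiff.clm_comp (ContMDiff.sub ?_ contMDiff_const) contMDiff_const
  refine (ρ.hom ρ).contMDiff_act.clm_comp (contMDiff_const.clm_comp ?_)
  exact (contMDiff_Ad.comp P.contMDiff_incl).comp (contMDiff_inv 𝓘(ℝ, EA) ∞)

/-- The Atiyah cocycle `R^∇ ∈ Z¹(A, (𝔩/𝔞)^* ⊗ End V)` of a connection. -/
def Connection.cocycle {P : LieGroupPair EA A EL L} {ρ : Rep EA A V} (D : P.Connection ρ) :
    (P.coeffRep ρ).cocycles :=
  ⟨⟨D.cocycleFun, D.contMDiff_cocycleFun⟩, fun a b => by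
    change D.cocycleFun (a * b) = (P.coeffRep ρ).act a (D.cocycleFun b) + D.cocycleFun a
    ext q v
    obtain ⟨l, rfl⟩ := P.subalg.mkQ_surjective q
    change D.cocycleFun (a * b) (P.subalg.mkQL l) v =
      ρ.act a (D.cocycleFun b (P.subalg.mkQL (Ad (P.incl a⁻¹) l)) (ρ.act a⁻¹ v)) +
        D.cocycleFun a (P.subalg.mkQL l) v
    simp only [D.cocycleFun_mk, mul_inv_rev, map_mul, Ad_mul, ContinuousLinearMap.comp_apply,
      mul_apply_eq_comp, map_sub]
    abel⟩

/-- The class in `H¹(A, (𝔩/𝔞)^* ⊗ End V)` of the Atiyah cocycle does not depend on the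
connection. -/
theorem Connection.mk_cocycle_eq {P : LieGroupPair EA A EL L} {ρ : Rep EA A V}
    (D D' : P.Connection ρ) :
    (Submodule.Quotient.mk D.cocycle : (P.coeffRep ρ).H1) = Submodule.Quotient.mk D'.cocycle := by
  rw [Submodule.Quotient.eq]
  refine ⟨P.subalg.liftQL (D.nabla - D'.nabla) ?_, ?_⟩
  · rintro _ ⟨x, rfl⟩
    change D.nabla (P.algIncl x) - D'.nabla (P.algIncl x) = 0
    rw [D.nabla_algIncl, D'.nabla_algIncl, sub_self]
  · ext a q v
    obtain ⟨l, rfl⟩ := P.subalg.mkQ_surjective q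
    change ρ.act a ((D.nabla (Ad (P.incl a⁻¹) l) - D'.nabla (Ad (P.incl a⁻¹) l)) (ρ.act a⁻¹ v)) -
        (D.nabla l - D'.nabla l) v =
      D.cocycleFun a (P.subalg.mkQL l) v - D'.cocycleFun a (P.subalg.mkQL l) v
    simp only [cocycleFun_mk, sub_apply, map_sub]
    abel

/-- The Atiyah class `[R^∇] ∈ H¹(A, (𝔩/𝔞)^* ⊗ End V)` of an `A`-module `V` with respect to the Lie
group pair `(L, A)`, where `∇` is any connection extending the action of the Lie algebra
of `A`. -/
def moduleAtiyahClass (P : LieGroupPair EA A EL L) (ρ : Rep EA A V) : (P.coeffRep ρ).H1 :=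
  Submodule.Quotient.mk (P.nonempty_connection ρ).some.cocycle

/-- The Atiyah class of the Lie group pair `(L, A)`: the one of the `A`-module `𝔩/𝔞`. -/
def atiyahClass (P : LieGroupPair EA A EL L) : (P.coeffRep P.quotRep).H1 :=
  P.moduleAtiyahClass P.quotRep

end LieGroupPair

/-- A matched pair of Lie groups `L = A ⋈ B`: two Lie subgroups `A` and `B` of `L` such that the
multiplication of `L` restricts to a diffeomorphism `A × B → L`. -/
structure MatchedPair
    (EA : Type*) [NormedAddCommGroup EA] [NormedSpace ℝ EA]
    (A : Type*) [TopologicalSpace A] [ChartedSpace EA A] [Group A]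
    (EB : Type*) [NormedAddCommGroup EB] [NormedSpace ℝ EB]
    (B : Type*) [TopologicalSpace B] [ChartedSpace EB B] [Group B]
    (EL : Type*) [NormedAddCommGroup EL] [NormedSpace ℝ EL]
    (L : Type*) [TopologicalSpace L] [ChartedSpace EL L] [Group L] where
  left : LieSubgroup EA A EL L
  right : LieSubgroup EB B EL L
  mulDiffeo : Diffeomorph (𝓘(ℝ, EA).prod 𝓘(ℝ, EB)) 𝓘(ℝ, EL) (A × B) L ∞
  mulDiffeo_apply : ∀ a b, mulDiffeo (a, b) = left.incl a * right.incl b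

namespace MatchedPair

variable {EA : Type*} [NormedAddCommGroup EA] [NormedSpace ℝ EA]
  {A : Type*} [TopologicalSpace A] [ChartedSpace EA A] [Group A]
  {EB : Type*} [NormedAddCommGroup EB] [NormedSpace ℝ EB]
  {B : Type*} [TopologicalSpace B] [ChartedSpace EB B] [Group B]
  {EL : Type*} [NormedAddCommGroup EL] [NormedSpace ℝ EL]
  {L : Type*} [TopologicalSpace L] [ChartedSpace EL L] [Group L]

/-- The Lie group pair `(L, A)` of a matched pair `L = A ⋈ B`. -/
def pair (M : MatchedPair EA A EB B EL L) : LieGroupPair EA A EL L where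
  toLieSubgroup := M.left
  isClosedEmbedding_incl := by
    have : T1Space B := ChartedSpace.t1Space EB B
    have h1 : IsClosedEmbedding (fun a : A => (a, (1 : B))) := by
      refine ⟨isEmbedding_prodMkLeft 1, ?_⟩
      have : Set.range (fun a : A => (a, (1 : B))) = Prod.snd ⁻¹' {1} := by
        ext ⟨a, b⟩
        simp [eq_comm]
      rw [this]
      exact isClosed_singleton.preimage continuous_snd
    have h2 := M.mulDiffeo.toHomeomorph.isClosedEmbedding.comp h1
    have h3 : (M.mulDiffeo.toHomeomorph ∘ fun a : A => (a, (1 : B))) = M.left.incl := by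
      ext a
      change M.mulDiffeo (a, 1) = _
      rw [M.mulDiffeo_apply, map_one, mul_one]
    rwa [h3] at h2

/-- The dressing action of `A` on `B`: `dressing a b` is the unique `b' ∈ B` with
`a b ∈ b' A` in `L`; it corresponds to the left translation by `a` under the
identification `B ≃ L/A`, `b ↦ b A`. It is obtained by decomposing `(a b)⁻¹` in `A B`. -/
def dressing (M : MatchedPair EA A EB B EL L) (a : A) (b : B) : B :=
  (M.mulDiffeo.symm (M.left.incl a * M.right.incl b)⁻¹).2⁻¹

theorem dressing_spec (M : MatchedPair EA A EB B EL L) (a : A) (b : B) :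
    ∃ a' : A, M.left.incl a * M.right.incl b = M.right.incl (M.dressing a b) * M.left.incl a' := by
  refine ⟨(M.mulDiffeo.symm (M.left.incl a * M.right.incl b)⁻¹).1⁻¹, ?_⟩
  have h := M.mulDiffeo_apply (M.mulDiffeo.symm (M.left.incl a * M.right.incl b)⁻¹).1
    (M.mulDiffeo.symm (M.left.incl a * M.right.incl b)⁻¹).2
  rw [Prod.mk.eta, Diffeomorph.apply_symm_apply] at h
  rw [dressing, map_inv M.right.incl, map_inv M.left.incl, ← mul_inv_rev, ← h, inv_inv]

theorem dressing_unique (M : MatchedPair EA A EB B EL L) {a a' : A} {b b' : B}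
    (h : M.left.incl a * M.right.incl b = M.right.incl b' * M.left.incl a') :
    M.dressing a b = b' := by
  have e : (M.left.incl a * M.right.incl b)⁻¹ = M.mulDiffeo (a'⁻¹, b'⁻¹) := by
    rw [h, M.mulDiffeo_apply]
    simp
  rw [dressing, e, Diffeomorph.symm_apply_apply, inv_inv]

end MatchedPair

end Pair

section Linearization

/-- An action of a Lie group `A` on a manifold `X` is linearized by the `A`-module `V` near a point
`x`: there is a diffeomorphism `Φ` from an open neighborhood `U` of `0` in `V` to an open
neighborhood of `x` in `X`, with `Φ 0 = x`, which is `A`-equivariant in the sense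
that `Φ (a · v) = a · Φ v` for all `a ∈ A` and `v ∈ U` such that `a · v ∈ U`. -/
def IsLinearizedNear
    {EA : Type*} [NormedAddCommGroup EA] [NormedSpace ℝ EA]
    {A : Type*} [TopologicalSpace A] [ChartedSpace EA A] [Group A]
    {V : Type*} [NormedAddCommGroup V] [NormedSpace ℝ V]
    (EX : Type*) [NormedAddCommGroup EX] [NormedSpace ℝ EX]
    {X : Type*} [TopologicalSpace X] [ChartedSpace EX X]
    (action : A → X → X) (ρ : Rep EA A V) (x : X) : Prop :=
  ∃ Φ : OpenPartialHomeomorph V X,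
    0 ∈ Φ.source ∧ Φ 0 = x ∧
    ContMDiffOn 𝓘(ℝ, V) 𝓘(ℝ, EX) ∞ Φ Φ.source ∧
    ContMDiffOn 𝓘(ℝ, EX) 𝓘(ℝ, V) ∞ Φ.symm Φ.target ∧
    ∀ (a : A) (v : V), v ∈ Φ.source → ρ.act a v ∈ Φ.source →
      Φ (ρ.act a v) = action a (Φ v)

end Linearization

end LiePair

end

/-!
An equivariant connection `∇` on `𝔩/𝔞` is the same thing as an `L`-invariant affine connection on
the homogeneous space `L/A`, since `T(L/A) = L ×_A 𝔩/𝔞`. The exponential map of an invariant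
connection at the base point is a local diffeomorphism `𝔩/𝔞 → L/A` that intertwines the isotropy
action `Ad` of `A` with left translation, and `L/A ≅ B` carries left translation to the dressing
action. So the dressing action is linearized by this exponential map as soon as an equivariant
connection exists, and the Atiyah class is exactly the obstruction: if the Atiyah cocycle of `∇` is
the coboundary of `τ`, then `∇ - τ` is equivariant
(`exists_isEquivariant_of_moduleAtiyahClass_eq_zero`).

Geodesics are written without tangent bundles. A curve in `L/A` is lifted to a curve `g` in `L`; with
`ξ = g⁻¹ g'` and `x` the class of `ξ` in `𝔩/𝔞`, the geodesic equation is `x' = -∇_ξ x`. Equivariance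
of `∇` makes it independent of the lift (`Connection.IsGeodesicAt.mul_incl`). Lifting to `B` turns it
into the equation `b⁻¹ b' = σ x`, `x' = -∇_{σ x} x`, with `σ : 𝔩/𝔞 ≅ 𝔟`. Its solution with `b 0 = 1`
and `x 0 = v` defines `Φ v = b 1`, a diffeomorphism near `0` (`exists_exponential`). If `b` is such a
solution, so is `a ▷ b` with initial velocity `Ad_a v` (`hasLogDeriv_dressing`), because `a b` and
`a ▷ b` are two lifts of one curve in `L/A`. By uniqueness of solutions `Φ (Ad_a v) = a ▷ Φ v`.

The analytic point is the smooth dependence of solutions of an ordinary differential equation on the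
initial value (`exists_smooth_flow`). It follows from the inverse function theorem in the Banach
space of continuous functions, where superposition with a smooth map is a smooth operation
(`contDiff_continuousMap_comp`).
-/

noncomputable section

set_option linter.unusedSectionVars false

namespace LiePair

/-! ### Superposition operators on continuous functions -/

section Nemytskii

universe u

variable {K : Type*} [TopologicalSpace K] [CompactSpace K]
  {E F : Type u} [NormedAddCommGroup E] [NormedSpace ℝ E] [NormedAddCommGroup F] [NormedSpace ℝ F]

/-- A continuous family of linear maps, indexed by a compact space, acts pointwise on the
continuous families of vectors. -/
def pointwiseApply (K : Type*) [TopologicalSpace K] [CompactSpace K] (E F : Type*)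
    [NormedAddCommGroup E] [NormedSpace ℝ E] [NormedAddCommGroup F] [NormedSpace ℝ F] :
    C(K, E →L[ℝ] F) →L[ℝ] C(K, E) →L[ℝ] C(K, F) :=
  LinearMap.mkContinuous₂
    (LinearMap.mk₂ ℝ (fun (T : C(K, E →L[ℝ] F)) (x : C(K, E)) =>
      (⟨fun t => T t (x t), T.continuous.clm_apply x.continuous⟩ : C(K, F)))
      (fun _ _ _ => by ext; rfl) (fun _ _ _ => by ext; rfl)
      (fun T x y => by ext t; exact (T t).map_add (x t) (y t))
      (fun c T x => by ext t; exact (T t).map_smul c (x t)))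
    1 fun T x => by
      rw [one_mul, ContinuousMap.norm_le _ (by positivity)]
      intro t
      exact (T t).le_of_opNorm_le_of_le (T.norm_coe_le_norm t) (x.norm_coe_le_norm t)

theorem hasFDerivAt_continuousMap_comp {f : C(E, F)} {f' : C(E, E →L[ℝ] F)}
    (hf : ∀ y, HasFDerivAt f (f' y) y) (x : C(K, E)) :
    HasFDerivAt (fun x : C(K, E) => f.comp x) (pointwiseApply K E F (f'.comp x)) x := by
  rw [hasFDerivAt_iff_isLittleO_nhds_zero, Asymptotics.isLittleO_iff]
  intro ε hε
  have huc := (isCompact_range x.continuous).uniformContinuousAt_of_continuousAt f'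
    (fun y _ => f'.continuous.continuousAt) (Metric.dist_mem_uniformity hε)
  obtain ⟨δ, hδ, huc⟩ := Metric.mem_uniformity_dist.1 huc
  filter_upwards [Metric.ball_mem_nhds (0 : C(K, E)) hδ] with h hh
  rw [mem_ball_zero_iff] at hh
  rw [ContinuousMap.norm_le _ (by positivity)]
  intro t
  have hb : ∀ y ∈ Metric.ball (x t) δ, ‖f' y - f' (x t)‖ ≤ ε := fun y hy => by
    have := huc (a := x t) (b := y) (by rwa [dist_comm]) ⟨t, rfl⟩
    simp only [Set.mem_ofPred_eq] at this
    rw [dist_eq_norm, norm_sub_rev] at this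
    exact this.le
  have hht : ‖h t‖ ≤ ‖h‖ := h.norm_coe_le_norm t
  have := (convex_ball (x t) δ).norm_image_sub_le_of_norm_hasFDerivWithin_le'
    (fun y _ => (hf y).hasFDerivWithinAt) hb (Metric.mem_ball_self hδ)
    (y := x t + h t) (by rw [mem_ball_iff_norm, add_sub_cancel_left]; exact hht.trans_lt hh)
  rw [add_sub_cancel_left] at this
  exact this.trans (by gcongr)

/-- Superposition with a smooth map is a smooth operation on continuous functions: its
derivative is superposition with the derivative, whence an induction on the order. -/
theorem contDiff_continuousMap_comp {f : C(E, F)} (hf : ContDiff ℝ ∞ f) :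
    ContDiff ℝ ∞ (fun x : C(K, E) => f.comp x) := by
  rw [contDiff_infty]
  intro n
  induction n generalizing F with
  | zero =>
    rw [Nat.cast_zero, contDiff_zero]
    exact ContinuousMap.continuous_postcomp f
  | succ n ih =>
    have hf' : ContDiff ℝ ∞ (fderiv ℝ f) := hf.fderiv_right (by simp)
    rw [Nat.cast_succ, contDiff_succ_iff_hasFDerivAt]
    let g : C(E, E →L[ℝ] F) := ⟨fderiv ℝ f, hf'.continuous⟩
    refine ⟨fun x => pointwiseApply K E F (g.comp x), ?_, fun x => hasFDerivAt_continuousMap_comp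
        (fun y => (hf.differentiable (by simp) y).hasFDerivAt) x⟩
    exact ContDiff.comp (g := pointwiseApply K E F) (ContinuousLinearMap.contDiff _)
      (ih (f := g) hf')

end Nemytskii

/-! ### Smooth dependence on initial values -/

section InverseFunction

variable {X Y : Type*} [NormedAddCommGroup X] [NormedSpace ℝ X] [CompleteSpace X]
  [NormedAddCommGroup Y] [NormedSpace ℝ Y]

/-- The inverse function theorem for `C^∞` maps, with the inverse smooth on a whole neighborhood.
(`ContDiffAt ℝ ∞` at a single point would only provide neighborhoods that shrink as the order
grows.) -/
theorem exists_openPartialHomeomorph_contDiffOn_symm {f : X → Y} {O : Set X} (hO : IsOpen O)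
    (hf : ContDiffOn ℝ ∞ f O) {a : X} (ha : a ∈ O) {f' : X ≃L[ℝ] Y}
    (hf' : HasFDerivAt f (f' : X →L[ℝ] Y) a) :
    ∃ e : OpenPartialHomeomorph X Y, (e : X → Y) = f ∧ a ∈ e.source ∧ e.source ⊆ O ∧
      ContDiffOn ℝ ∞ e.symm e.target := by
  have haf : ContDiffAt ℝ ∞ f a := hf.contDiffAt (hO.mem_nhds ha)
  let e₀ := haf.toOpenPartialHomeomorph f hf' (by simp)
  have hO' : IsOpen (O ∩ fderiv ℝ f ⁻¹' Set.range ((↑) : (X ≃L[ℝ] Y) → X →L[ℝ] Y)) :=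
    (hf.continuousOn_fderiv_of_isOpen hO (by simp)).isOpen_inter_preimage hO
      ContinuousLinearEquiv.isOpen
  let e := e₀.restrOpen _ hO'
  refine ⟨e, rfl, ⟨haf.mem_toOpenPartialHomeomorph_source hf' _, ha, f', hf'.fderiv.symm⟩,
    fun x hx => hx.2.1, fun y hy => ContDiffAt.contDiffWithinAt ?_⟩
  have hx : e.symm y ∈ e.source := e.map_target hy
  obtain ⟨g, hg⟩ := hx.2.2
  have hfx : ContDiffAt ℝ ∞ f (e.symm y) := hf.contDiffAt (hO.mem_nhds hx.2.1)
  exact e.contDiffAt_symm hy (f₀' := g)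
    (by rw [hg]; exact (hfx.differentiableAt (by simp)).hasFDerivAt) hfx

end InverseFunction

section Flow

universe u

variable {E : Type u} [NormedAddCommGroup E] [NormedSpace ℝ E] [CompleteSpace E]

theorem norm_primitive_le (x : C(Set.Icc (-2 : ℝ) 2, E)) (t : Set.Icc (-2 : ℝ) 2) :
    ‖∫ s in (0 : ℝ)..t, x (Set.projIcc (-2) 2 (by norm_num) s)‖ ≤ 2 * ‖x‖ := by
  refine (intervalIntegral.norm_integral_le_of_norm_le_const
    fun s _ => x.norm_coe_le_norm _).trans ?_
  rw [mul_comm]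
  gcongr
  rw [sub_zero]
  exact abs_le.2 t.2

theorem continuous_comp_projIcc (x : C(Set.Icc (-2 : ℝ) 2, E)) :
    Continuous fun s => x (Set.projIcc (-2) 2 (by norm_num) s) :=
  x.continuous.comp continuous_projIcc

/-- The primitive vanishing at `0` of a continuous function on `[-2, 2]`. -/
def primitive : C(Set.Icc (-2 : ℝ) 2, E) →L[ℝ] C(Set.Icc (-2 : ℝ) 2, E) :=
  LinearMap.mkContinuous
    { toFun := fun x =>
        ⟨fun t => ∫ s in (0 : ℝ)..t, x (Set.projIcc (-2) 2 (by norm_num) s),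
          (intervalIntegral.continuous_primitive
            (fun _ _ => (continuous_comp_projIcc x).intervalIntegrable _ _) 0).comp
              continuous_subtype_val⟩
      map_add' := fun x y => by
        ext t
        exact intervalIntegral.integral_add ((continuous_comp_projIcc x).intervalIntegrable _ _)
          ((continuous_comp_projIcc y).intervalIntegrable _ _)
      map_smul' := fun c x => by
        ext t
        exact intervalIntegral.integral_smul c _ }
    2 fun x => by
      rw [ContinuousMap.norm_le _ (by positivity)]
      exact norm_primitive_le x

/-- Let `p` be a zero of a smooth vector field `f` at which the derivative `N` of `f` has square
zero. The solutions of `x' = f x` that start near `p` exist on `(-2, 2)`, depend smoothly on their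
initial value, and the derivative at `p` of the time one map is `exp N = 1 + N`.

A solution with initial value `v` is a solution of `x - ∫ f ∘ x = v` in the Banach space of
continuous functions. The left hand side is a smooth function of `x`, whose derivative at the
constant `p` is `1 - P` with `P h = ∫ N h`; as `P² = 0`, this is invertible. So the inverse function
theorem yields the solutions and their smoothness at once. -/
theorem exists_smooth_flow {f : E → E} (hf : ContDiff ℝ ∞ f) {p : E} (hp : f p = 0)
    (hN : (fderiv ℝ f p).comp (fderiv ℝ f p) = 0) :
    ∃ (W : Set E) (x : E → ℝ → E), IsOpen W ∧ p ∈ W ∧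
      (∀ v ∈ W, x v 0 = v) ∧
      (∀ v ∈ W, ∀ t ∈ Set.Ioo (-2 : ℝ) 2, HasDerivAt (x v) (f (x v t)) t) ∧
      (∀ ε > 0, ∀ᶠ v in 𝓝 p, ∀ t, x v t ∈ Metric.ball p ε) ∧
      ContDiffOn ℝ ∞ (fun v => x v 1) W ∧
      HasFDerivAt (fun v => x v 1) (ContinuousLinearMap.id ℝ E + fderiv ℝ f p) p := by
  let I := Set.Icc (-2 : ℝ) 2
  let N := fderiv ℝ f p
  let J : C(I, E) →L[ℝ] C(I, E) := primitive
  have hNN : ∀ v, N (N v) = 0 := fun v => DFunLike.congr_fun hN v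
  let fc : C(E, E) := ⟨f, hf.continuous⟩
  have hf' : ContDiff ℝ ∞ (fderiv ℝ f) := hf.fderiv_right (by simp)
  let θ : C(I, E) → C(I, E) := fun x => x - J (fc.comp x)
  have hθ : ContDiff ℝ ∞ θ :=
    contDiff_id.sub (J.contDiff.comp (contDiff_continuousMap_comp (f := fc) hf))
  let c : E →L[ℝ] C(I, E) := ContinuousLinearMap.const ℝ I
  let P : C(I, E) →L[ℝ] C(I, E) :=
    J.comp (pointwiseApply I E E (ContinuousMap.const I N))
  have hP : ∀ h (t : I), P h t = ∫ s in (0 : ℝ)..t, N (h (Set.projIcc (-2) 2 (by norm_num) s)) :=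
    fun h t => rfl
  have hPP : ∀ h, P (P h) = 0 := by
    intro h
    ext t
    rw [hP]
    have : ∀ s, N (P h s) = 0 := fun s => by
      rw [hP, ← ContinuousLinearMap.intervalIntegral_comp_comm]
      · simp [hNN]
      · exact (N.continuous.comp (continuous_comp_projIcc h)).intervalIntegrable _ _
    simp [this]
  let P' : C(I, E) ≃L[ℝ] C(I, E) := ContinuousLinearEquiv.equivOfInverse
    (ContinuousLinearMap.id ℝ _ - P) (ContinuousLinearMap.id ℝ _ + P)
    (fun h => by simp [hPP]) (fun h => by simp [hPP])
  have hθ' : HasFDerivAt θ (P' : C(I, E) →L[ℝ] C(I, E)) (c p) := by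
    refine (hasFDerivAt_id _).sub (J.hasFDerivAt.comp (c p) ?_)
    exact hasFDerivAt_continuousMap_comp (f := fc) (f' := ⟨fderiv ℝ f, hf'.continuous⟩)
      (fun y => (hf.differentiable (by simp) y).hasFDerivAt) (c p)
  obtain ⟨e, he, hpe, -, hsm⟩ := exists_openPartialHomeomorph_contDiffOn_symm isOpen_univ
    hθ.contDiffOn (Set.mem_univ _) hθ'
  have hθp : θ (c p) = c p := by
    ext t
    change p - ∫ s in (0 : ℝ)..t, f p = p
    simp [hp]
  have hec : e (c p) = c p := by rw [he, hθp]
  have hesc : e.symm (c p) = c p := by conv_lhs => rw [← hec, e.left_inv hpe]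
  have hpt : c p ∈ e.target := hec ▸ e.map_source hpe
  let W : Set E := c ⁻¹' e.target
  have hW : IsOpen W := e.open_target.preimage c.continuous
  -- The integrals make sense for all `t`, but give a solution only inside `(-2, 2)`; there `q` is
  -- the identity.
  let q : ℝ → I := Set.projIcc (-2) 2 (by norm_num)
  have hS : ∀ v ∈ W, ∀ t : I, e.symm (c v) t = v + ∫ s in (0 : ℝ)..t, f (e.symm (c v) (q s)) := by
    intro v hv t
    have h := DFunLike.congr_fun (e.right_inv hv) t
    rw [he] at h
    change e.symm (c v) t - ∫ s in (0 : ℝ)..t, f (e.symm (c v) (q s)) = v at h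
    exact sub_eq_iff_eq_add.1 h
  have hq : ∀ t (ht : t ∈ I), q t = ⟨t, ht⟩ := fun t ht => Set.projIcc_of_mem _ ht
  have hev : ContDiffOn ℝ ∞ (fun v => e.symm (c v) (q 1)) W :=
    ContDiff.comp_contDiffOn (g := ContinuousMap.evalCLM ℝ (M := E) (q 1))
      (ContinuousLinearMap.contDiff _)
      (hsm.comp c.contDiff.contDiffOn (Set.mapsTo_preimage _ _))
  refine ⟨W, fun v t => e.symm (c v) (q t), hW, hpt, ?_, ?_, ?_, hev, ?_⟩
  · intro v hv
    refine (hS v hv _).trans ?_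
    rw [hq 0 (by simp [I])]
    simp
  · intro v hv t ht
    have h1 : Continuous fun s => f (e.symm (c v) (q s)) :=
      hf.continuous.comp (continuous_comp_projIcc (e.symm (c v)))
    have h2 := ((h1.integral_hasStrictDerivAt 0 t).hasDerivAt).const_add v
    refine h2.congr_of_eventuallyEq ?_
    filter_upwards [isOpen_Ioo.mem_nhds ht] with s hs
    rw [hS v hv, hq s (Set.Ioo_subset_Icc_self hs)]
  · intro ε hε
    have h1 : ContinuousAt (fun v => e.symm (c v)) p :=
      ContinuousAt.comp (g := e.symm) (f := c) (e.continuousAt_symm hpt) c.continuous.continuousAt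
    have h2 := h1.preimage_mem_nhds (Metric.ball_mem_nhds _ hε)
    filter_upwards [h2] with v hv t
    rw [Set.mem_preimage, hesc] at hv
    exact (ContinuousMap.dist_apply_le_dist (q t)).trans_lt hv
  · have h1 : HasFDerivAt e.symm (P'.symm : C(I, E) →L[ℝ] C(I, E)) (c p) :=
      e.hasFDerivAt_symm hpt (by rw [hesc, he]; exact hθ')
    have h2 := (ContinuousMap.evalCLM ℝ (M := E) (q 1)).hasFDerivAt.comp p
      (h1.comp p c.hasFDerivAt)
    convert! h2 using 1
    ext v
    change v + N v = v + ∫ s in (0 : ℝ)..q 1, N v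
    rw [hq 1 (by constructor <;> norm_num)]
    simp

/-- A smooth map on an open set agrees near each point of it with a smooth map on the whole
space. -/
theorem exists_contDiff_eventuallyEq [FiniteDimensional ℝ E] {F : Type*} [NormedAddCommGroup F]
    [NormedSpace ℝ F] {f : E → F} {O : Set E}
    (hO : IsOpen O) (hf : ContDiffOn ℝ ∞ f O) {p : E} (hp : p ∈ O) :
    ∃ g : E → F, ContDiff ℝ ∞ g ∧ g =ᶠ[𝓝 p] f := by
  obtain ⟨r, hr, hrO⟩ := Metric.nhds_basis_closedBall.mem_iff.1 (hO.mem_nhds hp)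
  let b : ContDiffBump p := ⟨r / 2, r, by positivity, by linarith⟩
  refine ⟨fun x => b x • f x, contDiff_iff_contDiffAt.2 fun x => ?_, ?_⟩
  · by_cases hx : x ∈ O
    · exact b.contDiff.contDiffAt.smul (hf.contDiffAt (hO.mem_nhds hx))
    · have h1 : x ∉ tsupport b := by
        rw [b.tsupport_eq]
        exact fun h => hx (hrO h)
      refine contDiffAt_const (c := 0) |>.congr_of_eventuallyEq ?_
      filter_upwards [notMem_tsupport_iff_eventuallyEq.1 h1] with y hy
      simp [hy]
  · filter_upwards [b.eventuallyEq_one] with x hx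
    simp [hx]

end Flow

/-! ### Differentials of maps between manifolds -/

section HasTangentAt

variable {E : Type*} [NormedAddCommGroup E] [NormedSpace ℝ E]
  {M : Type*} [TopologicalSpace M] [ChartedSpace E M]
  {E' : Type*} [NormedAddCommGroup E'] [NormedSpace ℝ E']
  {M' : Type*} [TopologicalSpace M'] [ChartedSpace E' M']
  {E'' : Type*} [NormedAddCommGroup E''] [NormedSpace ℝ E'']
  {M'' : Type*} [TopologicalSpace M''] [ChartedSpace E'' M'']

/-- `f` is differentiable at `x` with differential `T`, a map between the model spaces. -/
def HasTangentAt (f : M → M') (x : M) (T : E →L[ℝ] E') : Prop :=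
  HasMFDerivAt 𝓘(ℝ, E) 𝓘(ℝ, E') f x T

theorem HasTangentAt.mdifferentiableAt {f : M → M'} {x : M} {T : E →L[ℝ] E'}
    (h : HasTangentAt f x T) : MDifferentiableAt 𝓘(ℝ, E) 𝓘(ℝ, E') f x :=
  HasMFDerivAt.mdifferentiableAt h

theorem hasTangentAt_tangentAt {f : M → M'} {x : M}
    (h : MDifferentiableAt 𝓘(ℝ, E) 𝓘(ℝ, E') f x) : HasTangentAt f x (tangentAt f x : E →L[ℝ] E') :=
  h.hasMFDerivAt

theorem HasTangentAt.unique {f : M → M'} {x : M} {S T : E →L[ℝ] E'}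
    (hS : HasTangentAt f x S) (hT : HasTangentAt f x T) : S = T :=
  hasMFDerivAt_unique hS hT

theorem HasTangentAt.comp {g : M' → M''} {f : M → M'} {x : M} {y : M'} {S : E' →L[ℝ] E''}
    {T : E →L[ℝ] E'} (hg : HasTangentAt g y S) (hf : HasTangentAt f x T) (hxy : f x = y) :
    HasTangentAt (fun z => g (f z)) x (S.comp T) := by
  subst hxy
  exact HasMFDerivAt.comp x hg hf

theorem HasTangentAt.congr {f g : M → M'} {x : M} {T : E →L[ℝ] E'}
    (h : HasTangentAt f x T) (hfg : g =ᶠ[𝓝 x] f) : HasTangentAt g x T :=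
  HasMFDerivAt.congr_of_eventuallyEq h hfg

theorem hasTangentAt_iff_hasFDerivAt {f : E → E'} {x : E} {T : E →L[ℝ] E'} :
    HasTangentAt f x T ↔ HasFDerivAt f T x :=
  hasMFDerivAt_iff_hasFDerivAt

theorem hasTangentAt_id (x : M) : HasTangentAt (fun y : M => y) x (ContinuousLinearMap.id ℝ E) :=
  hasMFDerivAt_id x

theorem hasTangentAt_chartAt [IsManifold 𝓘(ℝ, E) 1 M] (x : M) :
    HasTangentAt (chartAt E x) x (ContinuousLinearMap.id ℝ E) := by
  have h := hasTangentAt_tangentAt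
    (mdifferentiableAt_atlas (I := 𝓘(ℝ, E)) (chart_mem_atlas E x) (mem_chart_source E x))
  convert! h using 1
  ext v
  refine Eq.symm ((DFunLike.congr_fun
    (mfderiv_chartAt_eq_tangentCoordChange (I := 𝓘(ℝ, E)) (mem_chart_source E x)) v).trans ?_)
  exact tangentCoordChange_self (I := 𝓘(ℝ, E)) (by simp)

theorem hasTangentAt_chartAt_symm [IsManifold 𝓘(ℝ, E) 1 M] (x : M) :
    HasTangentAt (chartAt E x).symm (chartAt E x x) (ContinuousLinearMap.id ℝ E) := by
  have h := hasTangentAt_tangentAt (mdifferentiableAt_atlas_symm (I := 𝓘(ℝ, E))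
    (chart_mem_atlas E x) (mem_chart_target E x))
  have h1 := (hasTangentAt_chartAt x).comp h ((chartAt E x).left_inv (mem_chart_source E x))
  have h2 := (hasTangentAt_id (E := E) (chartAt E x x)).congr
    (Filter.eventually_of_mem ((chartAt E x).open_target.mem_nhds (mem_chart_target E x))
      fun y hy => (chartAt E x).right_inv hy)
  convert! h using 1
  rw [h1.unique h2 |>.symm]
  rfl

end HasTangentAt

/-! ### Logarithmic derivatives of curves in Lie groups -/

section LogDeriv

open ContinuousLinearMap (toSpanSingleton)

variable {E : Type*} [NormedAddCommGroup E] [NormedSpace ℝ E]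
  {G : Type*} [TopologicalSpace G] [ChartedSpace E G] [Group G] [LieGroup 𝓘(ℝ, E) ∞ G]
  {F : Type*} [NormedAddCommGroup F] [NormedSpace ℝ F]
  {H : Type*} [TopologicalSpace H] [ChartedSpace F H] [Group H]
  {M : Type*} [TopologicalSpace M] [ChartedSpace F M]

theorem mdifferentiableAt_mul_left (a b : G) :
    MDifferentiableAt 𝓘(ℝ, E) 𝓘(ℝ, E) (fun h : G => a * h) b :=
  (contMDiff_mul_left (I := 𝓘(ℝ, E)) (n := ∞)).mdifferentiableAt (by simp)

theorem HasTangentAt.mul {f g : M → G} {x : M} {S T : F →L[ℝ] E} (hf : HasTangentAt f x S)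
    (hg : HasTangentAt g x T) (hfx : f x = 1) (hgx : g x = 1) :
    HasTangentAt (fun y => f y * g y) x (S + T) := by
  have hμ : MDifferentiableAt (𝓘(ℝ, E).prod 𝓘(ℝ, E)) 𝓘(ℝ, E) (fun p : G × G => p.1 * p.2)
      (f x, g x) := (contMDiff_mul 𝓘(ℝ, E) ∞).mdifferentiableAt (by simp)
  have h : HasMFDerivAt 𝓘(ℝ, F) 𝓘(ℝ, E) (fun y => f y * g y) x _ :=
    HasMFDerivAt.comp x hμ.hasMFDerivAt (HasMFDerivAt.prodMk hf hg)
  suffices e : S + T = ContinuousLinearMap.comp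
      (mfderiv (𝓘(ℝ, E).prod 𝓘(ℝ, E)) 𝓘(ℝ, E) (fun p : G × G => p.1 * p.2) (f x, g x) :
        E × E →L[ℝ] E) (S.prod T) by
    rw [HasTangentAt, e]
    exact h
  ext v
  refine Eq.trans ?_ (mfderiv_prod_eq_add_apply (v := ((S v, T v) : E × E)) hμ).symm
  have h1 : tangentAt (fun z : G => z * g x) (f x) = ContinuousLinearMap.id ℝ E := by
    simp only [hgx, mul_one]; exact tangentAt_id _
  have h2 : tangentAt (fun z : G => f x * z) (g x) = ContinuousLinearMap.id ℝ E := by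
    simp only [hfx, one_mul]; exact tangentAt_id _
  exact (congrArg₂ (· + ·) (DFunLike.congr_fun h1 (S v)) (DFunLike.congr_fun h2 (T v))).symm

/-- `ξ` is the left logarithmic derivative at time `t` of the curve `g` in a Lie group, i.e. the
velocity at time `t` of `s ↦ (g t)⁻¹ g s`, a curve that is at `1` at this time. -/
def HasLogDeriv (g : ℝ → G) (ξ : E) (t : ℝ) : Prop :=
  HasTangentAt (fun s => (g t)⁻¹ * g s) t (toSpanSingleton ℝ ξ)

namespace HasLogDeriv

variable {g k : ℝ → G} {ξ η : E} {t : ℝ}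

theorem unique (h : HasLogDeriv g ξ t) (h' : HasLogDeriv g η t) : ξ = η := by
  simpa using DFunLike.congr_fun (HasTangentAt.unique h h') 1

theorem hasTangentAt_comp (h : HasLogDeriv g ξ t) {f : G → M} {T : E →L[ℝ] F}
    (hf : HasTangentAt f 1 T) :
    HasTangentAt (fun s => f ((g t)⁻¹ * g s)) t (toSpanSingleton ℝ (T ξ)) := by
  have := hf.comp h (by simp)
  rwa [ContinuousLinearMap.comp_toSpanSingleton] at this

theorem hasTangentAt (h : HasLogDeriv g ξ t) :
    HasTangentAt g t (toSpanSingleton ℝ (tangentAt (fun h : G => g t * h) 1 ξ : E)) := by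
  have := h.hasTangentAt_comp (hasTangentAt_tangentAt (mdifferentiableAt_mul_left (g t) 1))
  simpa only [mul_inv_cancel_left] using this

theorem const_mul (h : HasLogDeriv g ξ t) (a : G) : HasLogDeriv (fun s => a * g s) ξ t := by
  simpa only [HasLogDeriv, mul_inv_rev, mul_assoc, inv_mul_cancel_left] using h

theorem map (h : HasLogDeriv g ξ t) [LieGroup 𝓘(ℝ, F) ∞ H] (φ : G →* H)
    (hφ : ContMDiff 𝓘(ℝ, E) 𝓘(ℝ, F) ∞ φ) :
    HasLogDeriv (fun s => φ (g s)) (tangentAt φ 1 ξ : F) t := by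
  have := h.hasTangentAt_comp (hasTangentAt_tangentAt (hφ.mdifferentiableAt (by simp)))
  simpa only [HasLogDeriv, map_mul, map_inv] using this

theorem mul (h : HasLogDeriv g ξ t) (h' : HasLogDeriv k η t) :
    HasLogDeriv (fun s => g s * k s) (Ad (k t)⁻¹ ξ + η) t := by
  have h1 := h.hasTangentAt_comp (hasTangentAt_tangentAt
    ((contMDiff_conj (E := E) (k t)⁻¹).mdifferentiableAt (by simp)))
  have h2 := h1.mul h' (by simp) (by simp)
  unfold HasLogDeriv
  convert! h2 using 1
  · ext s; group
  · ext; simp [Ad]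

end HasLogDeriv

theorem exists_hasLogDeriv {g : ℝ → G} {t : ℝ}
    (h : MDifferentiableAt 𝓘(ℝ, ℝ) 𝓘(ℝ, E) g t) : ∃ ξ : E, HasLogDeriv g ξ t := by
  have h1 := (hasTangentAt_tangentAt (mdifferentiableAt_mul_left (E := E) (g t)⁻¹ (g t))).comp
    (hasTangentAt_tangentAt h) rfl
  refine ⟨(tangentAt (fun h : G => (g t)⁻¹ * h) (g t) : E →L[ℝ] E)
    ((tangentAt g t : ℝ →L[ℝ] E) 1), ?_⟩
  unfold HasLogDeriv
  convert! h1 using 1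
  ext
  simp

theorem eq_of_hasTangentAt_zero {k : ℝ → M} {a b : ℝ}
    (h : ∀ t ∈ Set.Ioo a b, HasTangentAt k t (0 : ℝ →L[ℝ] F)) [IsManifold 𝓘(ℝ, F) 1 M]
    {s t : ℝ} (hs : s ∈ Set.Ioo a b) (ht : t ∈ Set.Ioo a b) : k s = k t := by
  refine isPreconnected_Ioo.induction₂ (fun s t => k s = k t) (fun t ht => ?_)
    (fun _ _ _ _ _ _ => Eq.trans) (fun _ _ _ _ => Eq.symm) hs ht
  have hk : ContinuousAt k t := (h t ht).mdifferentiableAt.continuousAt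
  let φ := chartAt F (k t)
  have hn : k ⁻¹' φ.source ∩ Set.Ioo a b ∈ 𝓝 t := Filter.inter_mem
    (hk.preimage_mem_nhds (φ.open_source.mem_nhds (mem_chart_source F (k t))))
    (isOpen_Ioo.mem_nhds ht)
  obtain ⟨r, hr, hball⟩ := Metric.mem_nhds_iff.1 hn
  have hd : ∀ s ∈ Metric.ball t r, HasFDerivAt (fun s => φ (k s)) (0 : ℝ →L[ℝ] F) s := by
    intro s hs
    have h1 := hasTangentAt_tangentAt (mdifferentiableAt_atlas (I := 𝓘(ℝ, F))
      (chart_mem_atlas F (k t)) (hball hs).1)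
    have h2 := h1.comp (h s (hball hs).2) rfl
    rw [ContinuousLinearMap.comp_zero] at h2
    exact hasTangentAt_iff_hasFDerivAt.1 h2
  filter_upwards [mem_nhdsWithin_of_mem_nhds (Metric.ball_mem_nhds t hr)] with s hs
  refine φ.injOn (hball (Metric.mem_ball_self hr)).1 (hball hs).1 ?_
  exact Metric.isOpen_ball.is_const_of_fderiv_eq_zero (convex_ball t r).isPreconnected
    (fun s hs => (hd s hs).differentiableAt.differentiableWithinAt)
    (fun s hs => (hd s hs).fderiv) (Metric.mem_ball_self hr) hs

/-- A curve in a Lie group is determined by its logarithmic derivative and its initial value: if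
`g` and `k` have the same logarithmic derivative, that of `g k⁻¹` vanishes. -/
theorem HasLogDeriv.eq_of_eq {g k : ℝ → G} {η : ℝ → E} {a b : ℝ}
    (hg : ∀ t ∈ Set.Ioo a b, HasLogDeriv g (η t) t)
    (hk : ∀ t ∈ Set.Ioo a b, HasLogDeriv k (η t) t)
    {s t : ℝ} (hs : s ∈ Set.Ioo a b) (ht : t ∈ Set.Ioo a b) (h : g s = k s) : g t = k t := by
  have : IsManifold 𝓘(ℝ, E) 1 G := IsManifold.of_le (n := ∞) (by simp)
  have hz : ∀ t ∈ Set.Ioo a b, HasTangentAt (fun s => g s * (k s)⁻¹) t (0 : ℝ →L[ℝ] E) := by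
    intro t ht
    have hd : MDifferentiableAt 𝓘(ℝ, ℝ) 𝓘(ℝ, E) (fun s => g s * (k s)⁻¹) t := by
      have h1 : ContMDiff (𝓘(ℝ, E).prod 𝓘(ℝ, E)) 𝓘(ℝ, E) ∞ (fun p : G × G => p.1 * p.2⁻¹) :=
        contMDiff_fst.mul contMDiff_snd.inv
      exact (h1.mdifferentiableAt (by simp)).comp t
        ((hg t ht).hasTangentAt.mdifferentiableAt.prodMk (hk t ht).hasTangentAt.mdifferentiableAt)
    obtain ⟨κ, hκ⟩ := exists_hasLogDeriv hd
    -- The product rule for `g = (g k⁻¹) k` reads `η = Ad (k t)⁻¹ κ + η`.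
    have h2 := (hκ.mul (hk t ht)).unique (η := η t) (by simpa using hg t ht)
    rw [add_eq_right] at h2
    have h3 : κ = 0 := by
      have := congrArg (Ad (k t) : E →L[ℝ] E) h2
      rwa [map_zero, ← ContinuousLinearMap.comp_apply, ← Ad_mul, mul_inv_cancel, Ad_one] at this
    have h4 := hκ.hasTangentAt
    rwa [h3, map_zero, ContinuousLinearMap.toSpanSingleton_zero] at h4
  have := eq_of_hasTangentAt_zero hz hs ht
  rw [h, mul_inv_cancel] at this
  exact (mul_inv_eq_one.1 this.symm)

end LogDeriv

/-! ### Left translations in a chart -/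

section Chart

variable (E : Type*) [NormedAddCommGroup E] [NormedSpace ℝ E]
  (G : Type*) [TopologicalSpace G] [ChartedSpace E G] [Group G] [LieGroup 𝓘(ℝ, E) ∞ G]

/-- The multiplication of a Lie group in the preferred chart at `1`. -/
def chartMul (p : E × E) : E :=
  chartAt E (1 : G) ((chartAt E (1 : G)).symm p.1 * (chartAt E (1 : G)).symm p.2)

/-- The set of the points where the multiplication is defined in the preferred chart at `1`. -/
def chartMulSource : Set (E × E) :=
  ((chartAt E (1 : G)).target ×ˢ (chartAt E (1 : G)).target) ∩
    (fun p => (chartAt E (1 : G)).symm p.1 * (chartAt E (1 : G)).symm p.2) ⁻¹'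
      (chartAt E (1 : G)).source

theorem contMDiffOn_chart_symm_mul_chart_symm :
    ContMDiffOn 𝓘(ℝ, E × E) 𝓘(ℝ, E) ∞
      (fun p : E × E => (chartAt E (1 : G)).symm p.1 * (chartAt E (1 : G)).symm p.2)
      ((chartAt E (1 : G)).target ×ˢ (chartAt E (1 : G)).target) := by
  have h := contMDiffOn_chart_symm (I := 𝓘(ℝ, E)) (n := ∞) (x := (1 : G))
  exact (h.comp contDiff_fst.contMDiff.contMDiffOn fun p hp => hp.1).mul
    (h.comp contDiff_snd.contMDiff.contMDiffOn fun p hp => hp.2)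

theorem isOpen_chartMulSource : IsOpen (chartMulSource E G) :=
  (contMDiffOn_chart_symm_mul_chart_symm E G).continuousOn.isOpen_inter_preimage
    ((chartAt E (1 : G)).open_target.prod (chartAt E (1 : G)).open_target)
    (chartAt E (1 : G)).open_source

theorem contDiffOn_chartMul : ContDiffOn ℝ ∞ (chartMul E G) (chartMulSource E G) :=
  contMDiffOn_iff_contDiffOn.1 <| (contMDiffOn_chart (I := 𝓘(ℝ, E)) (n := ∞)
    (x := (1 : G))).comp ((contMDiffOn_chart_symm_mul_chart_symm E G).mono fun _ hp => hp.1)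
      fun _ hp => hp.2

theorem chart_symm_chart_one : (chartAt E (1 : G)).symm (chartAt E (1 : G) 1) = 1 :=
  (chartAt E (1 : G)).left_inv (mem_chart_source E 1)

variable {E} in
theorem mk_one_mem_chartMulSource {z : E} (hz : z ∈ (chartAt E (1 : G)).target) :
    (z, chartAt E (1 : G) 1) ∈ chartMulSource E G := by
  refine ⟨⟨hz, mem_chart_target E 1⟩, ?_⟩
  rw [Set.mem_preimage, chart_symm_chart_one, mul_one]
  exact (chartAt E (1 : G)).map_target hz

variable {E} in
/-- In the preferred chart at `1`, the differential at `1` of the left translation by the point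
with coordinate `z`. -/
def chartLeft (z : E) : E →L[ℝ] E :=
  (fderiv ℝ (chartMul E G) (z, chartAt E (1 : G) 1)).comp (ContinuousLinearMap.inr ℝ E E)

theorem contDiffOn_chartLeft : ContDiffOn ℝ ∞ (chartLeft (E := E) G) (chartAt E (1 : G)).target := by
  have h1 : ContDiffOn ℝ ∞ (fderiv ℝ (chartMul E G)) (chartMulSource E G) :=
    (contDiffOn_chartMul E G).fderiv_of_isOpen (isOpen_chartMulSource E G) (by simp)
  have h2 : ContDiffOn ℝ ∞ (fun z : E => fderiv ℝ (chartMul E G) (z, chartAt E (1 : G) 1))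
      (chartAt E (1 : G)).target :=
    h1.comp (contDiff_id.prodMk contDiff_const).contDiffOn
      fun z hz => mk_one_mem_chartMulSource G hz
  exact h2.clm_comp contDiffOn_const

variable {E G}

theorem hasFDerivAt_chartMul_right {z : E} (hz : z ∈ (chartAt E (1 : G)).target) :
    HasFDerivAt (fun w => chartMul E G (z, w)) (chartLeft G z) (chartAt E (1 : G) 1) := by
  have h1 := ((contDiffOn_chartMul E G).contDiffAt ((isOpen_chartMulSource E G).mem_nhds
    (mk_one_mem_chartMulSource G hz))).differentiableAt (by simp)
  exact h1.hasFDerivAt.comp (chartAt E (1 : G) 1) (hasFDerivAt_prodMk_right z _)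

theorem chartLeft_chart_one :
    chartLeft G (chartAt E (1 : G) 1) = ContinuousLinearMap.id ℝ E := by
  refine (hasFDerivAt_chartMul_right (mem_chart_target E 1)).unique
    ((hasFDerivAt_id _).congr_of_eventuallyEq ?_)
  filter_upwards [(chartAt E (1 : G)).open_target.mem_nhds (mem_chart_target E 1)] with w hw
  rw [chartMul, chart_symm_chart_one, one_mul, (chartAt E (1 : G)).right_inv hw, id]

/-- In coordinates, the equation `g⁻¹ g' = η` for a curve `g` is `z' = chartLeft z η`. -/
theorem hasLogDeriv_chart_symm {z : ℝ → E} {η : E} {t : ℝ}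
    (hz : z t ∈ (chartAt E (1 : G)).target) (h : HasDerivAt z (chartLeft G (z t) η) t) :
    HasLogDeriv (fun s => (chartAt E (1 : G)).symm (z s)) η t := by
  have : IsManifold 𝓘(ℝ, E) 1 G := IsManifold.of_le (n := ∞) (by simp)
  let φ := chartAt E (1 : G)
  have h1 := (hasTangentAt_tangentAt (mdifferentiableAt_mul_left (E := E) (φ.symm (z t))⁻¹
    (φ.symm (z t)))).comp (hasTangentAt_tangentAt (mdifferentiableAt_atlas_symm (I := 𝓘(ℝ, E))
      (chart_mem_atlas E (1 : G)) hz)) rfl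
  set T : E →L[ℝ] E := (tangentAt (fun h => (φ.symm (z t))⁻¹ * h) (φ.symm (z t)) : E →L[ℝ] E).comp
    (tangentAt φ.symm (z t))
  have hm : chartMul E G (z t, φ 1) = z t := by
    rw [chartMul, chart_symm_chart_one, mul_one, φ.right_inv hz]
  have h2 := h1.comp (hasTangentAt_iff_hasFDerivAt.2 (hasFDerivAt_chartMul_right hz)) hm
  -- `T` is the differential of `y ↦ (φ.symm (z t))⁻¹ * φ.symm y`, which undoes the left translation
  -- by `φ.symm (z t)` in the chart.
  have h3 : T.comp (chartLeft G (z t)) = ContinuousLinearMap.id ℝ E := by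
    refine h2.unique ((hasTangentAt_chartAt_symm (1 : G)).congr ?_)
    have ho : {w | (z t, w) ∈ chartMulSource E G} ∈ 𝓝 (φ 1) :=
      ((isOpen_chartMulSource E G).preimage (Continuous.prodMk_right (z t))).mem_nhds
        (mk_one_mem_chartMulSource G hz)
    filter_upwards [ho] with w hw
    rw [chartMul, (chartAt E (1 : G)).left_inv hw.2, inv_mul_cancel_left]
  have h4 := h1.comp (hasTangentAt_iff_hasFDerivAt.2 h.hasFDerivAt) rfl
  unfold HasLogDeriv
  convert! h4 using 1
  ext
  simpa using! (DFunLike.congr_fun h3 η).symm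

end Chart

/-! ### Equivariant connections and the geodesic equation -/

section Representation

variable {E : Type*} [NormedAddCommGroup E] [NormedSpace ℝ E]
  {A : Type*} [TopologicalSpace A] [ChartedSpace E A] [Group A] [LieGroup 𝓘(ℝ, E) ∞ A]
  {V : Type*} [NormedAddCommGroup V] [NormedSpace ℝ V]

/-- This is the product rule for `w w⁻¹ = 1`. -/
theorem HasLogDeriv.inv {w : ℝ → A} {κ : E} {t : ℝ} (h : HasLogDeriv w κ t) :
    HasLogDeriv (fun s => (w s)⁻¹) (-(Ad (w t) κ : E)) t := by
  have hd : MDifferentiableAt 𝓘(ℝ, ℝ) 𝓘(ℝ, E) (fun s => (w s)⁻¹) t :=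
    ((contMDiff_inv 𝓘(ℝ, E) ∞).mdifferentiableAt (by simp)).comp t h.hasTangentAt.mdifferentiableAt
  obtain ⟨κ', hκ'⟩ := exists_hasLogDeriv hd
  have h1 := h.mul hκ'
  have h2 : HasLogDeriv (fun s => w s * (w s)⁻¹) (0 : E) t := by
    simp only [HasLogDeriv, mul_inv_cancel, ContinuousLinearMap.toSpanSingleton_zero]
    exact hasMFDerivAt_const _ _
  have h3 := h1.unique h2
  rw [inv_inv] at h3
  rwa [← eq_neg_of_add_eq_zero_right h3]

theorem Rep.hasDerivAt_act (ρ : Rep E A V) {w : ℝ → A} {κ : E} {t : ℝ} (h : HasLogDeriv w κ t) :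
    HasDerivAt (fun s => ρ.act (w s)) ((ρ.act (w t)).comp (ρ.infinitesimal κ)) t := by
  have h1 := h.hasTangentAt_comp (hasTangentAt_tangentAt
    (ρ.contMDiff_act.mdifferentiableAt (by simp)))
  have h2 := (hasTangentAt_iff_hasFDerivAt.1 h1).hasDerivAt
  have h3 := (hasDerivAt_const t (ρ.act (w t))).clm_comp h2
  convert! h3 using 1
  · ext s v
    change _ = ρ.act (w t) (ρ.act _ v)
    rw [← ρ.act_mul_apply, mul_inv_cancel_left]
  · simp [Rep.infinitesimal]

theorem Rep.hasDerivAt_act_inv (ρ : Rep E A V) {w : ℝ → A} {κ : E} {t : ℝ}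
    (h : HasLogDeriv w κ t) :
    HasDerivAt (fun s => ρ.act (w s)⁻¹) (-(ρ.infinitesimal κ).comp (ρ.act (w t)⁻¹)) t := by
  convert! ρ.hasDerivAt_act h.inv using 1
  rw [map_neg, ρ.infinitesimal_Ad]
  ext v
  simp [← ρ.act_mul_apply]

end Representation

namespace LieGroupPair

variable {EA : Type*} [NormedAddCommGroup EA] [NormedSpace ℝ EA] [FiniteDimensional ℝ EA]
  {A : Type*} [TopologicalSpace A] [ChartedSpace EA A] [Group A] [LieGroup 𝓘(ℝ, EA) ∞ A]
  {EL : Type*} [NormedAddCommGroup EL] [NormedSpace ℝ EL] [FiniteDimensional ℝ EL]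
  {L : Type*} [TopologicalSpace L] [ChartedSpace EL L] [Group L] [LieGroup 𝓘(ℝ, EL) ∞ L]
  {V : Type*} [NormedAddCommGroup V] [NormedSpace ℝ V]
  {P : LieGroupPair EA A EL L}

/-- A connection is equivariant if `∇_{Ad a l} (a · v) = a · ∇_l v` for all `a ∈ A`. -/
def Connection.IsEquivariant {ρ : Rep EA A V} (D : P.Connection ρ) : Prop :=
  ∀ (a : A) (l : EL) (v : V),
    D.nabla (Ad (P.incl a) l) (ρ.act a v) = ρ.act a (D.nabla l v)

/-- If the Atiyah cocycle of a connection is the coboundary of `τ`, subtracting `τ` makes the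
connection equivariant. -/
theorem exists_isEquivariant_of_moduleAtiyahClass_eq_zero {ρ : Rep EA A V}
    (h : P.moduleAtiyahClass ρ = 0) : ∃ D : P.Connection ρ, D.IsEquivariant := by
  rw [moduleAtiyahClass, Submodule.Quotient.mk_eq_zero] at h
  obtain ⟨τ, hτ⟩ := h
  set D := (P.nonempty_connection ρ).some
  have hτ' : ∀ a, (P.coeffRep ρ).act a τ - τ = D.cocycleFun a := fun a =>
    congrArg (fun F : (P.coeffRep ρ).cocycles => F.1 a) hτ
  refine ⟨⟨D.nabla - τ.comp P.subalg.mkQL, fun x => ?_⟩, fun a l v => ?_⟩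
  · have h0 : P.subalg.mkQL (P.algIncl x) = 0 :=
      (Submodule.Quotient.mk_eq_zero _).2 ⟨x, rfl⟩
    simp [h0, D.nabla_algIncl]
  · have h1 := DFunLike.congr_fun (DFunLike.congr_fun (hτ' a)
      (P.subalg.mkQL (Ad (P.incl a) l))) (ρ.act a v)
    rw [D.cocycleFun_mk] at h1
    have h2 : Ad (P.incl a⁻¹) (Ad (P.incl a) l : EL) = l := by
      rw [← ContinuousLinearMap.comp_apply, ← Ad_mul, ← map_mul, inv_mul_cancel, map_one, Ad_one]
      rfl
    have h3 : ρ.act a⁻¹ (ρ.act a v) = v := by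
      rw [← ρ.act_mul_apply, inv_mul_cancel, ρ.act_one_apply]
    have h4 : (P.coeffRep ρ).act a τ (P.subalg.mkQL (Ad (P.incl a) l)) (ρ.act a v) =
        ρ.act a (τ (P.subalg.mkQL (Ad (P.incl a⁻¹) (Ad (P.incl a) l : EL)))
          (ρ.act a⁻¹ (ρ.act a v))) := rfl
    rw [h2, h3] at h1 h4
    rw [sub_apply, sub_apply, h4] at h1
    simp only [sub_apply, ContinuousLinearMap.comp_apply, map_sub]
    rw [sub_eq_sub_iff_add_eq_add] at h1 ⊢
    rw [add_comm, ← h1, add_comm]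

/-- At time `t`, the pair of curves `g` in `L` and `x` in `𝔩/𝔞` satisfies the geodesic equation
of the connection: the velocity `ξ = g⁻¹ g'` is a lift of `x` to `𝔩` and `x' = -∇_ξ x`. Through
`T(L/A) = L ×_A 𝔩/𝔞`, an equivariant `∇` is an `L`-invariant affine connection on `L/A`, and the
curve `g A` is then a geodesic of it, with velocity `[g, x]`. -/
def Connection.IsGeodesicAt (D : P.Connection P.quotRep) (g : ℝ → L) (x : ℝ → P.AlgQuot)
    (t : ℝ) : Prop :=
  ∃ ξ : EL, HasLogDeriv g ξ t ∧ P.subalg.mkQL ξ = x t ∧ HasDerivAt x (-D.nabla ξ (x t)) t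

theorem Connection.IsGeodesicAt.const_mul {D : P.Connection P.quotRep} {g : ℝ → L}
    {x : ℝ → P.AlgQuot} {t : ℝ} (h : D.IsGeodesicAt g x t) (l : L) :
    D.IsGeodesicAt (fun s => l * g s) x t := by
  obtain ⟨ξ, hξ, h⟩ := h
  exact ⟨ξ, hξ.const_mul l, h⟩

/-- The geodesic equation of an equivariant connection does not depend on the choice of the lift
to `L` of a curve in `L/A`. -/
theorem Connection.IsGeodesicAt.mul_incl {D : P.Connection P.quotRep} (hD : D.IsEquivariant)
    {g : ℝ → L} {x : ℝ → P.AlgQuot} {t : ℝ} (h : D.IsGeodesicAt g x t) {w : ℝ → A}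
    (hw : MDifferentiableAt 𝓘(ℝ, ℝ) 𝓘(ℝ, EA) w t) :
    D.IsGeodesicAt (fun s => g s * P.incl (w s)) (fun s => P.quotRep.act (w s)⁻¹ (x s)) t := by
  obtain ⟨ξ, hξ, hx, hx'⟩ := h
  obtain ⟨κ, hκ⟩ := exists_hasLogDeriv hw
  have h0 : P.subalg.mkQL (P.algIncl κ) = 0 := (Submodule.Quotient.mk_eq_zero _).2 ⟨κ, rfl⟩
  refine ⟨_, hξ.mul (hκ.map P.incl P.contMDiff_incl), ?_, ?_⟩
  · change P.subalg.mkQL (Ad (P.incl (w t))⁻¹ ξ + P.algIncl κ) = _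
    rw [map_add, h0, add_zero, ← map_inv, ← P.quotAd_mk, hx]
    rfl
  · convert! (P.quotRep.hasDerivAt_act_inv hκ).clm_apply hx' using 1
    change -D.nabla (Ad (P.incl (w t))⁻¹ ξ + P.algIncl κ) _ = _
    rw [map_add, D.nabla_algIncl, ← map_inv, add_apply, hD, map_neg, neg_add_rev]
    rfl

end LieGroupPair

/-! ### The exponential map of a left invariant connection -/

section Exponential

variable {E : Type*} [NormedAddCommGroup E] [NormedSpace ℝ E] [FiniteDimensional ℝ E]
  {G : Type*} [TopologicalSpace G] [ChartedSpace E G] [Group G] [LieGroup 𝓘(ℝ, E) ∞ G]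
  {V : Type*} [NormedAddCommGroup V] [NormedSpace ℝ V] [FiniteDimensional ℝ V]

/-- The exponential map at `1` of a left invariant affine connection on a Lie group `G`, as a local
diffeomorphism. Here `V` is identified with the Lie algebra of `G` by `σ`, and the connection is
given by its values `Γ x y` on left invariant vector fields; the geodesic with initial velocity `v`
is the curve `g` with `g 0 = 1` and `g⁻¹ g' = σ x`, where `x' = -Γ x x` and `x 0 = v`. -/
theorem exists_exponential (σ : V ≃L[ℝ] E) (Γ : V →L[ℝ] V →L[ℝ] V) :
    ∃ Φ : OpenPartialHomeomorph V G, 0 ∈ Φ.source ∧ Φ 0 = 1 ∧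
      ContMDiffOn 𝓘(ℝ, V) 𝓘(ℝ, E) ∞ Φ Φ.source ∧
      ContMDiffOn 𝓘(ℝ, E) 𝓘(ℝ, V) ∞ Φ.symm Φ.target ∧
      ∀ v ∈ Φ.source, ∃ (g : ℝ → G) (x : ℝ → V), g 0 = 1 ∧ x 0 = v ∧ g 1 = Φ v ∧
        ∀ t ∈ Set.Ioo (-2 : ℝ) 2, HasLogDeriv g (σ (x t)) t ∧
          HasDerivAt x (-Γ (x t) (x t)) t := by
  have : CompleteSpace E := FiniteDimensional.complete ℝ E
  have : CompleteSpace V := FiniteDimensional.complete ℝ V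
  let φ := chartAt E (1 : G)
  let p : E × V := (φ 1, 0)
  let F : E × V → E × V := fun q => (chartLeft G q.1 (σ q.2), -Γ q.2 q.2)
  have hO : IsOpen (φ.target ×ˢ (Set.univ : Set V)) := φ.open_target.prod isOpen_univ
  have hpO : p ∈ φ.target ×ˢ (Set.univ : Set V) := ⟨mem_chart_target E 1, trivial⟩
  have hF1 : ContDiffOn ℝ ∞ (fun q : E × V => chartLeft G q.1) (φ.target ×ˢ Set.univ) :=
    (contDiffOn_chartLeft E G).comp contDiff_fst.contDiffOn fun q hq => hq.1
  have hF : ContDiffOn ℝ ∞ F (φ.target ×ˢ Set.univ) :=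
    (hF1.clm_apply (σ.contDiff.comp contDiff_snd).contDiffOn).prodMk
      ((Γ.contDiff.comp contDiff_snd).clm_apply contDiff_snd).neg.contDiffOn
  let N : E × V →L[ℝ] E × V :=
    ((σ : V →L[ℝ] E).comp (ContinuousLinearMap.snd ℝ E V)).prod 0
  have hF' : HasFDerivAt F N p := by
    have h1 := (((hF1.contDiffAt (hO.mem_nhds hpO)).differentiableAt
      (by simp)).hasFDerivAt.clm_apply ((σ : V →L[ℝ] E).comp
        (ContinuousLinearMap.snd ℝ E V)).hasFDerivAt)
    have h2 := ((Γ.comp (ContinuousLinearMap.snd ℝ E V)).hasFDerivAt (x := p)).clm_apply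
      (ContinuousLinearMap.snd ℝ E V).hasFDerivAt
    convert! h1.prodMk h2.neg using 1
    ext q <;> simp [N, p, φ, chartLeft_chart_one]
  -- `F` is the equation in the chart at `1`. It is only defined near `p`, so the flow is taken for a
  -- global field `f` that agrees with it near `p`, where solutions with initial value near `p` stay.
  obtain ⟨f, hf, hfF⟩ := exists_contDiff_eventuallyEq hO hF hpO
  have hfN : fderiv ℝ f p = N := (hF'.congr_of_eventuallyEq hfF).fderiv
  have hp : f p = 0 := by
    rw [hfF.eq_of_nhds]
    simp [F, p]
  obtain ⟨W, X, hW, hpW, hX0, hX, hXp, hXs, hX'⟩ := exists_smooth_flow hf hp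
    (by rw [hfN]; ext q <;> simp [N])
  obtain ⟨ε, hε, hball⟩ := Metric.mem_nhds_iff.1 (Filter.inter_mem hfF (hO.mem_nhds hpO))
  have hXp1 : X p 1 = p := by
    refine eq_of_forall_dist_le fun δ hδ => ?_
    exact (Metric.mem_ball.1 ((hXp δ hδ).self_of_nhds 1)).le
  let j : V → E × V := fun v => (φ 1, v)
  have hj : ContDiff ℝ ∞ j := contDiff_const.prodMk contDiff_id
  let U : Set V := j ⁻¹' (W ∩ interior {v | ∀ t, X v t ∈ Metric.ball p ε})
  have hU : IsOpen U := (hW.inter isOpen_interior).preimage hj.continuous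
  have h0U : (0 : V) ∈ U := ⟨hpW, mem_interior_iff_mem_nhds.2 (hXp ε hε)⟩
  let θ : V → E := fun v => (X (j v) 1).1
  have hθ : ContDiffOn ℝ ∞ θ U :=
    contDiff_fst.comp_contDiffOn (hXs.comp hj.contDiffOn fun v hv => hv.1)
  have hθ' : HasFDerivAt θ (σ : V →L[ℝ] E) 0 := by
    have h1 := hasFDerivAt_fst.comp (0 : V) (HasFDerivAt.comp (0 : V) (f := j)
      (g := fun v => X v 1) hX' (hasFDerivAt_prodMk_right (φ 1) (0 : V)))
    convert! h1 using 1
    ext v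
    simp [hfN, N]
  obtain ⟨ψ, hψ, hψ0, hψU, hψs⟩ :=
    exists_openPartialHomeomorph_contDiffOn_symm hU hθ h0U hθ'
  have hψ1 : ψ 0 = φ 1 := by rw [hψ]; exact congrArg Prod.fst hXp1
  refine ⟨ψ.trans φ.symm, ?_, ?_, ?_, ?_, ?_⟩
  · rw [OpenPartialHomeomorph.trans_source]
    exact ⟨hψ0, by rw [Set.mem_preimage, hψ1]; exact mem_chart_target E 1⟩
  · change φ.symm (ψ 0) = 1
    rw [hψ1, chart_symm_chart_one]
  · refine (contMDiffOn_chart_symm (I := 𝓘(ℝ, E)) (n := ∞) (x := (1 : G))).comp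
      (t := φ.target) (f := ψ) ?_ fun v hv => ?_
    · rw [hψ]
      exact (hθ.mono fun v hv => hψU (ψ.trans_source φ.symm ▸ hv).1).contMDiffOn
    · exact (ψ.trans_source φ.symm ▸ hv).2
  · refine (contMDiffOn_iff_contDiffOn.2 hψs).comp (f := φ)
      ((contMDiffOn_chart (I := 𝓘(ℝ, E)) (n := ∞) (x := (1 : G))).mono fun y hy => ?_)
      fun y hy => ?_
    · exact (ψ.trans_target φ.symm ▸ hy).1
    · exact (ψ.trans_target φ.symm ▸ hy).2
  · intro v hv
    have hvU := hψU (ψ.trans_source φ.symm ▸ hv).1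
    have hXv : X (j v) 0 = j v := hX0 _ hvU.1
    refine ⟨fun t => φ.symm (X (j v) t).1, fun t => (X (j v) t).2, ?_, ?_, ?_, fun t ht => ?_⟩
    · simp only [hXv]
      exact chart_symm_chart_one E G
    · simp only [hXv, j]
    · change _ = φ.symm (ψ v)
      rw [hψ]
    · have h1 := hball (interior_subset hvU.2 t)
      have h2 := hX _ hvU.1 t ht
      rw [show f (X (j v) t) = F (X (j v) t) from h1.1] at h2
      exact ⟨hasLogDeriv_chart_symm h1.2.1 h2.fst, h2.snd⟩

/-- Solutions of a homogeneous quadratic differential equation are determined by their initial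
value. -/
theorem eq_of_hasDerivAt_quadratic {Γ : V →L[ℝ] V →L[ℝ] V} {x y : ℝ → V}
    (hx : ∀ t ∈ Set.Ioo (-2 : ℝ) 2, HasDerivAt x (-Γ (x t) (x t)) t)
    (hy : ∀ t ∈ Set.Ioo (-2 : ℝ) 2, HasDerivAt y (-Γ (y t) (y t)) t) (h : x 0 = y 0)
    {t : ℝ} (ht : t ∈ Set.Ioo (-2 : ℝ) 2) : x t = y t := by
  obtain ⟨b, hb, hb2⟩ := exists_between (abs_lt.2 ht)
  have hb0 : 0 < b := (abs_nonneg t).trans_lt hb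
  -- On `[-b, b]`, both solutions stay in a ball, where the equation is Lipschitz.
  have hsub : Set.Icc (-b) b ⊆ Set.Ioo (-2) 2 := fun s hs =>
    ⟨by linarith [hs.1], by linarith [hs.2]⟩
  have hbd : ∀ z : ℝ → V, (∀ t ∈ Set.Ioo (-2 : ℝ) 2, HasDerivAt z (-Γ (z t) (z t)) t) →
      ∃ C, ∀ s ∈ Set.Icc (-b) b, ‖z s‖ ≤ C := fun z hz =>
    isCompact_Icc.exists_bound_of_continuousOn fun s hs =>
      (hz s (hsub hs)).continuousAt.continuousWithinAt
  obtain ⟨C, hC⟩ := hbd x hx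
  obtain ⟨C', hC'⟩ := hbd y hy
  have hR : 0 ≤ max C C' := (norm_nonneg _).trans
    ((hC 0 ⟨by linarith, hb0.le⟩).trans (le_max_left C C'))
  have hlip : ∀ s ∈ Set.Ioo (-b) b, LipschitzOnWith (2 * ‖Γ‖₊ * ⟨max C C', hR⟩)
      (fun z => -Γ z z) (Metric.closedBall 0 (max C C')) := fun s _ =>
    LipschitzOnWith.of_dist_le_mul fun z hz z' hz' => by
      rw [mem_closedBall_zero_iff] at hz hz'
      have e : -Γ z z - -Γ z' z' = Γ (z' - z) z' + Γ z (z' - z) := by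
        simp only [map_sub, sub_apply]; abel
      rw [dist_eq_norm, dist_comm z z', dist_eq_norm, e]
      refine (norm_add_le_of_le (Γ.le_opNorm₂ _ _) (Γ.le_opNorm₂ _ _)).trans ?_
      change _ ≤ 2 * ‖Γ‖ * max C C' * ‖z' - z‖
      calc ‖Γ‖ * ‖z' - z‖ * ‖z'‖ + ‖Γ‖ * ‖z‖ * ‖z' - z‖
          ≤ ‖Γ‖ * ‖z' - z‖ * max C C' + ‖Γ‖ * max C C' * ‖z' - z‖ := by gcongr
        _ = 2 * ‖Γ‖ * max C C' * ‖z' - z‖ := by ring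
  refine ODE_solution_unique_of_mem_Ioo hlip (t₀ := 0) ⟨by linarith, hb0⟩ (fun s hs => ?_)
    (fun s hs => ?_) h (abs_lt.1 hb)
  · have hs' := Set.Ioo_subset_Icc_self hs
    exact ⟨hx s (hsub hs'), mem_closedBall_zero_iff.2 ((hC s hs').trans (le_max_left _ _))⟩
  · have hs' := Set.Ioo_subset_Icc_self hs
    exact ⟨hy s (hsub hs'), mem_closedBall_zero_iff.2 ((hC' s hs').trans (le_max_right _ _))⟩

end Exponential

/-! ### The dressing action of a matched pair -/

namespace MatchedPair

variable {EA : Type*} [NormedAddCommGroup EA] [NormedSpace ℝ EA] [FiniteDimensional ℝ EA]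
  {A : Type*} [TopologicalSpace A] [ChartedSpace EA A] [Group A] [LieGroup 𝓘(ℝ, EA) ∞ A]
  {EB : Type*} [NormedAddCommGroup EB] [NormedSpace ℝ EB] [FiniteDimensional ℝ EB]
  {B : Type*} [TopologicalSpace B] [ChartedSpace EB B] [Group B] [LieGroup 𝓘(ℝ, EB) ∞ B]
  {EL : Type*} [NormedAddCommGroup EL] [NormedSpace ℝ EL] [FiniteDimensional ℝ EL]
  {L : Type*} [TopologicalSpace L] [ChartedSpace EL L] [Group L] [LieGroup 𝓘(ℝ, EL) ∞ L]
  (M : MatchedPair EA A EB B EL L)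

/-- The inclusion of the Lie algebra of `B` in the Lie algebra of `L`. -/
def rightAlgIncl : EB →L[ℝ] EL := tangentAt M.right.incl 1

/-- The map is the differential at `(1, 1)` of the diffeomorphism `A × B → L`. -/
theorem bijective_algIncl_add_rightAlgIncl :
    Function.Bijective fun p : EA × EB => M.pair.algIncl p.1 + M.rightAlgIncl p.2 := by
  have hd := M.mulDiffeo.contMDiff_toFun.mdifferentiableAt (x := (1, 1)) (by simp)
  have h1 : (fun a => M.mulDiffeo (a, 1)) = M.left.incl := by
    ext a; rw [M.mulDiffeo_apply, map_one, mul_one]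
  have h2 : (fun b => M.mulDiffeo (1, b)) = M.right.incl := by
    ext b; rw [M.mulDiffeo_apply, map_one, one_mul]
  convert! (M.mulDiffeo.mfderivToContinuousLinearEquiv (by simp) (1, 1)).bijective using 1
  ext p
  refine Eq.symm ((mfderiv_prod_eq_add_apply (v := p) hd).trans ?_)
  exact congrArg₂ (· + ·)
    (congrArg (fun f => (tangentAt f (1 : A) : EA →L[ℝ] EL) p.1) h1)
    (congrArg (fun f => (tangentAt f (1 : B) : EB →L[ℝ] EL) p.2) h2)

theorem bijective_mkQL_rightAlgIncl :
    Function.Bijective (M.pair.subalg.mkQL.comp M.rightAlgIncl) := by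
  obtain ⟨hi, hs⟩ := M.bijective_algIncl_add_rightAlgIncl
  constructor
  · refine (injective_iff_map_eq_zero _).2 fun y hy => ?_
    obtain ⟨x, hx⟩ := (Submodule.Quotient.mk_eq_zero _).1 hy
    have h : (-x, y) = ((0, 0) : EA × EB) := hi <| by
      change M.pair.algIncl (-x) + M.rightAlgIncl y = M.pair.algIncl 0 + M.rightAlgIncl 0
      rw [← show M.pair.algIncl x = M.rightAlgIncl y from hx]
      simp
    exact congrArg Prod.snd h
  · intro q
    obtain ⟨l, rfl⟩ := M.pair.subalg.mkQ_surjective q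
    obtain ⟨⟨x, y⟩, rfl⟩ := hs l
    refine ⟨y, ?_⟩
    have h0 : M.pair.subalg.mkQL (M.pair.algIncl x) = 0 :=
      (Submodule.Quotient.mk_eq_zero _).2 ⟨x, rfl⟩
    change M.pair.subalg.mkQL (M.rightAlgIncl y) =
      M.pair.subalg.mkQL (M.pair.algIncl x + M.rightAlgIncl y)
    rw [map_add, h0, zero_add]

/-- The Lie algebra of `B` is a complement of `𝔞` in `𝔩`, so it is identified with `𝔩/𝔞`. -/
def quotEquiv : M.pair.AlgQuot ≃L[ℝ] EB :=
  (LinearEquiv.ofBijective (M.pair.subalg.mkQL.comp M.rightAlgIncl).toLinearMap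
    M.bijective_mkQL_rightAlgIncl).symm.toContinuousLinearEquiv

theorem mkQL_rightAlgIncl (y : EB) :
    M.pair.subalg.mkQL (M.rightAlgIncl y) = M.quotEquiv.symm y := rfl

/-- If `b` and `x` solve the geodesic equation of an equivariant connection, written with lifts
to `B`, then so do the dressed curve `a ▷ b` and a suitable `y`: the curves `a b` and `a ▷ b` are
two lifts to `L` of the same curve in `L/A`. Here `y` is `x` transported by the factor in `A` that
relates these lifts. -/
theorem hasLogDeriv_dressing {D : M.pair.Connection M.pair.quotRep} (hD : D.IsEquivariant)
    {b : ℝ → B} {x : ℝ → M.pair.AlgQuot} {t : ℝ}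
    (hb : HasLogDeriv b (M.quotEquiv (x t)) t)
    (hx : HasDerivAt x (-D.nabla (M.rightAlgIncl (M.quotEquiv (x t))) (x t)) t) (a : A) :
    let y : ℝ → M.pair.AlgQuot := fun s => M.pair.quotRep.act
      (M.mulDiffeo.symm (M.left.incl a * M.right.incl (b s))⁻¹).1⁻¹ (x s)
    HasLogDeriv (fun s => M.dressing a (b s)) (M.quotEquiv (y t)) t ∧
      HasDerivAt y (-D.nabla (M.rightAlgIncl (M.quotEquiv (y t))) (y t)) t := by
  intro y
  have hg : D.IsGeodesicAt (fun s => M.right.incl (b s)) x t :=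
    ⟨_, hb.map M.right.incl M.right.contMDiff_incl,
      (M.mkQL_rightAlgIncl _).trans (M.quotEquiv.symm_apply_apply _), hx⟩
  let p : ℝ → A × B := fun s => M.mulDiffeo.symm (M.left.incl a * M.right.incl (b s))⁻¹
  have hsm : ContMDiff 𝓘(ℝ, EB) (𝓘(ℝ, EA).prod 𝓘(ℝ, EB)) ∞
      (fun h : B => M.mulDiffeo.symm (M.left.incl a * M.right.incl h)⁻¹) :=
    M.mulDiffeo.symm.contMDiff_toFun.comp (contMDiff_const.mul M.right.contMDiff_incl).inv
  have hbt := hb.hasTangentAt.mdifferentiableAt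
  have hw : MDifferentiableAt 𝓘(ℝ, ℝ) 𝓘(ℝ, EA) (fun s => (p s).1) t :=
    ((contMDiff_fst.comp hsm).mdifferentiableAt (by simp)).comp t hbt
  have hc : MDifferentiableAt 𝓘(ℝ, ℝ) 𝓘(ℝ, EB) (fun s => M.dressing a (b s)) t :=
    ((contMDiff_snd.comp hsm).inv.mdifferentiableAt (by simp)).comp t hbt
  obtain ⟨ξ, hξ, hξy, hy⟩ := (hg.const_mul (M.left.incl a)).mul_incl hD hw
  obtain ⟨η, hη⟩ := exists_hasLogDeriv hc
  have e : (fun s => M.left.incl a * M.right.incl (b s) * M.pair.incl (p s).1) =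
      fun s => M.right.incl (M.dressing a (b s)) := by
    ext s
    have h := M.mulDiffeo_apply (p s).1 (p s).2
    rw [Prod.mk.eta, show M.mulDiffeo (p s) = _ from M.mulDiffeo.apply_symm_apply _] at h
    rw [← inv_inv (M.left.incl a * M.right.incl (b s)), h]
    change _ * M.left.incl (p s).1 = M.right.incl (p s).2⁻¹
    simp
  rw [e] at hξ
  have h1 : ξ = M.rightAlgIncl η := hξ.unique (hη.map M.right.incl M.right.contMDiff_incl)
  rw [h1, mkQL_rightAlgIncl] at hξy
  have h2 : η = M.quotEquiv (y t) := (M.quotEquiv.symm_apply_eq).1 hξy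
  rw [h1] at hy
  exact ⟨h2 ▸ hη, h2 ▸ hy⟩

theorem dressing_one (a : A) : M.dressing a 1 = 1 :=
  M.dressing_unique (a' := a) (by simp)

end MatchedPair
end LiePair
end

theorem mainTheorem12
    {EA : Type*} [NormedAddCommGroup EA] [NormedSpace ℝ EA] [FiniteDimensional ℝ EA]
    {A : Type*} [TopologicalSpace A] [ChartedSpace EA A] [Group A] [LieGroup 𝓘(ℝ, EA) ∞ A]
    {EB : Type*} [NormedAddCommGroup EB] [NormedSpace ℝ EB] [FiniteDimensional ℝ EB]
    {B : Type*} [TopologicalSpace B] [ChartedSpace EB B] [Group B] [LieGroup 𝓘(ℝ, EB) ∞ B]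
    {EL : Type*} [NormedAddCommGroup EL] [NormedSpace ℝ EL] [FiniteDimensional ℝ EL]
    {L : Type*} [TopologicalSpace L] [ChartedSpace EL L] [Group L] [LieGroup 𝓘(ℝ, EL) ∞ L]
    (M : LiePair.MatchedPair EA A EB B EL L)
    (hM : M.pair.atiyahClass = 0) :
    LiePair.IsLinearizedNear EB M.dressing M.pair.quotRep (1 : B) := by
  obtain ⟨D, hD⟩ := LiePair.LieGroupPair.exists_isEquivariant_of_moduleAtiyahClass_eq_zero hM
  have : FiniteDimensional ℝ M.pair.AlgQuot :=
    inferInstanceAs (FiniteDimensional ℝ (EL ⧸ M.pair.subalg))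
  let Γ : M.pair.AlgQuot →L[ℝ] M.pair.AlgQuot →L[ℝ] M.pair.AlgQuot :=
    D.nabla.comp (M.rightAlgIncl.comp (M.quotEquiv : M.pair.AlgQuot →L[ℝ] EB))
  obtain ⟨Φ, h0, hΦ0, hs, hs', hΦ⟩ := LiePair.exists_exponential (G := B) M.quotEquiv Γ
  refine ⟨Φ, h0, hΦ0, hs, hs', fun a v hv hav => ?_⟩
  obtain ⟨b, x, hb0, hx0, hb1, hbx⟩ := hΦ v hv
  obtain ⟨c, z, hc0, hz0, hc1, hcz⟩ := hΦ _ hav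
  -- The dressed curve `s ↦ a ▷ b s` and `c` are geodesics with the same initial velocity.
  let y : ℝ → M.pair.AlgQuot := fun s => M.pair.quotRep.act
    (M.mulDiffeo.symm (M.left.incl a * M.right.incl (b s))⁻¹).1⁻¹ (x s)
  have hy : ∀ t ∈ Set.Ioo (-2 : ℝ) 2,
      LiePair.HasLogDeriv (fun s => M.dressing a (b s)) (M.quotEquiv (y t)) t ∧
        HasDerivAt y (-Γ (y t) (y t)) t := fun t ht =>
    M.hasLogDeriv_dressing hD (hbx t ht).1 (hbx t ht).2 a
  have hy0 : y 0 = z 0 := by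
    have h : (M.left.incl a * M.right.incl (1 : B))⁻¹ = M.mulDiffeo (a⁻¹, 1) := by
      rw [M.mulDiffeo_apply]; simp
    simp only [y, hb0, hx0, hz0, h, Diffeomorph.symm_apply_apply, inv_inv]
  have hyz : ∀ t ∈ Set.Ioo (-2 : ℝ) 2, y t = z t := fun t ht =>
    LiePair.eq_of_hasDerivAt_quadratic (fun t ht => (hy t ht).2) (fun t ht => (hcz t ht).2) hy0 ht
  have h1 := LiePair.HasLogDeriv.eq_of_eq (η := fun t => M.quotEquiv (z t))
    (fun t ht => (hcz t ht).1) (fun t ht => hyz t ht ▸ (hy t ht).1)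
    (s := 0) (t := 1) (by constructor <;> norm_num) (by constructor <;> norm_num)
    (by rw [hc0, hb0, M.dressing_one])
  rw [← hc1, ← hb1, h1]
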